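/- **Theorem (General LOCC inequality).** Let $A=A_1\ldots A_n$ and $A'=A'_1\ldots A'_n$ be $n$-partite quantum systems with separable, possibly infinite-dimensional local Hilbert spaces, each with a fixed orthonormal basis; complex conjugation $^*$ and (partial) transposition are taken in the product bases. Let $\mathcal E=\{\mathrm d\mu(\alpha),\psi_\alpha\}$ be an ensemble of pure states on $A$: $\mu$ is a probability measure (discrete or not), $\alpha\mapsto|\psi_\alpha\rangle\in\mathcal H_A$ is a measurable family of unit vectors, and $\psi_\alpha=|\psi_\alpha\rangle\langle\psi_\alpha|$. Let $U:\mathcal H_A\to\mathcal H_{A'}$ be an isometry and $\psi'_\alpha=U\psi_\alpha U^\dagger$. Put $$F_{\mathcal C}(\mathcal E,U)=\sup_{\Lambda\in\mathcal C}\int \mathrm d\mu(\alpha)\,\mathrm{Tr}[\Lambda(\psi_\alpha)\psi'_\alpha],\qquad R_{AA'}=\int \mathrm d\mu(\alpha)\,(\psi_\alpha^*)_A\otimes(\psi'_\alpha)_{A'},\qquad R_A=\mathrm{Tr}_{A'}R_{AA'},$$ where $\mathcal C$ is either the set $\mathrm{LOCC}(A\to A')$ of channels that are realised by local operations and classical communication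 or are pointwise limits of such channels, or the set $\mathrm{PPT}(A\to A')$ of channels whose Choi operator $\sum_{a,b}|a\rangle\langle b|\otimes\Lambda(|a\rangle\langle b|)$ has positive semidefinite partial transposes $\Gamma_J$ (tested on vectors of finite support) for all $J\subseteq[n]=\{1,\dots,n\}$. Here $\Gamma_J$ is the partial transposition over all $A_j,A'_j$ with $j\in J$. Let $d_{\max}(X\|Y)=\inf\{\lambda>0: X\le\lambda Y\}\in[0,\infty]$ and, for an operator $L$ on $AA'$, let $H_{\min}(A'|A)_L=-\log\inf_{\xi_A}d_{\max}(L\,\|\,\xi_A\otimes\mathbb 1_{A'})$, the infimum being over density operators $\xi_A$ on $A$, with $\log 0=-\infty$ and $\log\infty=\infty$. 1. $F_{\mathrm{LOCC}}(\mathcal E,U)\le F_{\mathrm{PPT}}(\mathcal E,U)$, and both are at most $$\min_{J\subseteq[n]}\exp\left[-H_{\min}(A'|A)_{R^{\Gamma_J}}\right]=\min_{J\subseteq[n]}\inf_{\xi_A}d_{\max}\left(R_{AA'}^{\Gamma_J}\,\big\|\,\xi_A\otimes\mathbb 1_{A'}\right)=\min_{J\subseteq[n]}\inf\left\{\kappa\ge0:\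 R_{AA'}^{\Gamma_J}\le\kappa\,\xi_A\otimes\mathbb 1_{A'}\text{ for some state }\xi_A\right\}.$$ 2. The value at $J$ of the quantity $\exp[-H_{\min}(A'|A)_{R^{\Gamma_J}}]$ equals that at $[n]\setminus J$, and its value at $J=\emptyset$ is at least $1$. Hence one may restrict to $1\le|J|\le\lfloor n/2\rfloor$ without loss: the minimum over all $J$ and the minimum over these $J$ (which is $+\infty$ if there are none) agree after taking the minimum of each with the trivial bound $1$. 3. If $|\psi_\alpha\rangle=\bigotimes_{j=1}^n|\psi_{\alpha,j}\rangle$ is a product of unit vectors for every $\alpha$, then $F_{\mathrm{LOCC}}(\mathcal E,U)$ and $F_{\mathrm{PPT}}(\mathcal E,U)$ are at most $$\min_{J\subseteq[n]}d_{\max}\left(R_{AA'}^{\Gamma_J}\,\big\|\,R_A^{\Gamma_J}\otimes\mathbb 1_{A'}\right)\le 1 .$$ In fact $d_{\max}(R_{AA'}^{\Gamma_J}\|R_A^{\Gamma_J}\otimes\mathbb 1_{A'})\le1$ for every $J$, the value at $J$ equals that at $[n]\setminus J$, and for $n\ge2$ the minimum is unchanged if restricted to $1\le|J|\le\lfloor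 n/2\rfloor$. -/

import Mathlib

open scoped ENNReal InnerProductSpace ComplexOrder Topology

noncomputable section

namespace LOCCBound

/-! ### Hilbert spaces with a chosen orthonormal basis

A separable Hilbert space with a chosen orthonormal basis indexed by a countable type `ι` is, in
coordinates, the space `ℓ²(ι)`.  The Hilbert tensor product of `ℓ²(ι)` and `ℓ²(κ)` is `ℓ²(ι × κ)`,
and that of the spaces `ℓ²(I j)`, `j : Fin n`, is `ℓ²(∀ j, I j)`. -/

/-- The Hilbert space with orthonormal basis indexed by `ι`. -/
abbrev Hilb (ι : Type) : Type := lp (fun _ : ι => ℂ) 2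

/-- Bounded operators. -/
abbrev Op (ι : Type) : Type := Hilb ι →L[ℂ] Hilb ι

open Classical in
/-- The basis vector with label `a`. -/
def ket {ι : Type} (a : ι) : Hilb ι := lp.single 2 a (1 : ℂ)

/-- The matrix of a bounded operator in the chosen basis. -/
def entry {ι : Type} (X : Op ι) : Matrix ι ι ℂ :=
  Matrix.of fun a b => ⟪ket a, X (ket b)⟫_ℂ

theorem inner_ket {ι : Type} (a : ι) (x : Hilb ι) : ⟪ket a, x⟫_ℂ = x a := by
  classical
  unfold ket
  have := lp.inner_single_left (𝕜 := ℂ) (G := fun _ : ι => ℂ) a (1 : ℂ) x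
  simp only [RCLike.inner_apply, map_one, mul_one] at this
  convert this

theorem ket_apply {ι : Type} [DecidableEq ι] (a b : ι) :
    (ket a : Hilb ι) b = if b = a then 1 else 0 := by
  simp [ket, Pi.single_apply]

theorem hasSum_normSq {ι : Type} (x : Hilb ι) : HasSum (fun a => ‖x a‖ ^ 2) (‖x‖ ^ 2) := by
  have h := lp.hasSum_norm (p := 2) (by norm_num) x
  simpa using h

theorem memHilb {ι : Type} {f : ι → ℂ} (h : Summable fun a => ‖f a‖ ^ 2) :
    Memℓp (E := fun _ : ι => ℂ) f 2 := by
  apply memℓp_gen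
  simpa using h

/-- A linear map into functions that is bounded in the `ℓ²` sense, as a bounded operator. -/
def mkOp {ι κ : Type} (f : Hilb ι →ₗ[ℂ] (κ → ℂ)) (C : ℝ) (hC : 0 ≤ C)
    (h : ∀ x, ∀ s : Finset κ, ∑ a ∈ s, ‖f x a‖ ^ 2 ≤ (C * ‖x‖) ^ 2) : Hilb ι →L[ℂ] Hilb κ :=
  LinearMap.mkContinuous
    { toFun := fun x => ⟨f x, memHilb (summable_of_sum_le (fun _ => by positivity) (h x))⟩
      map_add' := fun x y => Subtype.ext (map_add f x y)
      map_smul' := fun c x => Subtype.ext (map_smul f c x) } C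
    (fun x => by
      refine lp.norm_le_of_forall_sum_le (p := 2) (by norm_num) (by positivity) fun s => ?_
      simpa using h x s)

/-! ### Hilbert--Schmidt operators -/

/-- A matrix is Hilbert--Schmidt if its entries are square summable. -/
def IsHSMatrix {ι : Type} (M : Matrix ι ι ℂ) : Prop :=
  Summable fun p : ι × ι => ‖M p.1 p.2‖ ^ 2

def hsRow {ι : Type} (M : Matrix ι ι ℂ) (hM : IsHSMatrix M) (a : ι) : Hilb ι :=
  ⟨fun b => star (M a b), memHilb (by
    simpa [Function.comp_def] using
      Summable.comp_injective (i := fun b => (a, b)) hM (fun b b' h => by simpa using h))⟩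

theorem sum_hsRow {ι : Type} (M : Matrix ι ι ℂ) (hM : IsHSMatrix M) (s : Finset ι) :
    ∑ a ∈ s, ‖hsRow M hM a‖ ^ 2 ≤ ∑' p : ι × ι, ‖M p.1 p.2‖ ^ 2 := by
  have h1 : ∀ a, ∑' b, ‖M a b‖ ^ 2 = ‖hsRow M hM a‖ ^ 2 := fun a => by
    have := (hasSum_normSq (hsRow M hM a)).tsum_eq
    simpa [hsRow] using this
  have h2 := hM.prod
  rw [hM.tsum_prod]
  simp only [h1] at h2 ⊢
  exact h2.sum_le_tsum s fun _ _ => by positivity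

/-- The bounded operator with Hilbert--Schmidt matrix `M`. -/
def hsOp {ι : Type} (M : Matrix ι ι ℂ) (hM : IsHSMatrix M) : Op ι :=
  mkOp (LinearMap.pi fun a => innerₛₗ ℂ (hsRow M hM a))
    (Real.sqrt (∑' p : ι × ι, ‖M p.1 p.2‖ ^ 2)) (Real.sqrt_nonneg _) (by
      intro x s
      rw [mul_pow, Real.sq_sqrt (tsum_nonneg fun _ => by positivity)]
      refine le_trans ?_ (mul_le_mul_of_nonneg_right (sum_hsRow M hM s) (by positivity))
      rw [Finset.sum_mul]
      refine Finset.sum_le_sum fun a _ => ?_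
      rw [← mul_pow]
      exact pow_le_pow_left₀ (norm_nonneg _) (norm_inner_le_norm (𝕜 := ℂ) (hsRow M hM a) x) 2)

theorem entry_hsOp {ι : Type} (M : Matrix ι ι ℂ) (hM : IsHSMatrix M) : entry (hsOp M hM) = M := by
  classical
  ext a b
  change ⟪ket a, hsOp M hM (ket b)⟫_ℂ = _
  rw [inner_ket]
  change ⟪hsRow M hM a, ket b⟫_ℂ = _
  rw [← inner_conj_symm, inner_ket]
  simp [hsRow]

open Classical in
/-- The operator with matrix `M`; only meant for Hilbert--Schmidt matrices. -/
def ofMatrix {ι : Type} (M : Matrix ι ι ℂ) : Op ι :=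
  if hM : IsHSMatrix M then hsOp M hM else 0

/-! ### Tensor products -/

/-- The vector `u ⊗ w`. -/
def tensorVec {ι κ : Type} (u : Hilb ι) (w : Hilb κ) : Hilb (ι × κ) :=
  ⟨fun p => u p.1 * w p.2, memHilb (by
    have := (hasSum_normSq u).summable.mul_of_nonneg (hasSum_normSq w).summable
      (fun _ => by positivity) (fun _ => by positivity)
    simpa [mul_pow] using this)⟩

/-- The component `(1 ⊗ ⟨c|) x` of a vector `x`. -/
def slice {ι κ : Type} (c : κ) : Hilb (ι × κ) →ₗ[ℂ] Hilb ι where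
  toFun x := ⟨fun a => x (a, c), memHilb ((hasSum_normSq x).summable.comp_injective
    (i := fun a => (a, c)) (fun a b h => by simpa using h))⟩
  map_add' _ _ := rfl
  map_smul' _ _ := rfl

theorem sum_slice {ι κ : Type} (x : Hilb (ι × κ)) (s : Finset κ) :
    ∑ c ∈ s, ‖slice c x‖ ^ 2 ≤ ‖x‖ ^ 2 := by
  have h := (hasSum_normSq x).summable
  have h0 := (Equiv.prodComm κ ι).summable_iff.2 h
  have h1 : ∀ c, ∑' a, ‖x (a, c)‖ ^ 2 = ‖slice c x‖ ^ 2 := fun c =>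
    (hasSum_normSq (slice c x)).tsum_eq
  have h2 := h0.prod
  have h3 := ((Equiv.prodComm κ ι).tsum_eq (fun p => ‖x p‖ ^ 2)).symm.trans h0.tsum_prod
  rw [(hasSum_normSq x).tsum_eq] at h3
  simp only [Function.comp_apply, Equiv.prodComm_apply, Prod.swap_prod_mk, h1] at h2 h3
  rw [h3]
  exact h2.sum_le_tsum s fun _ _ => by positivity

/-- The operator `X ⊗ 1`. -/
def tensorOne {ι : Type} (κ : Type) (X : Op ι) : Op (ι × κ) :=
  mkOp (LinearMap.pi fun p : ι × κ =>
      (innerₛₗ ℂ (ket p.1)).comp (X.toLinearMap.comp (slice p.2)))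
    ‖X‖ (norm_nonneg _) (by
      classical
      intro x s
      have hsub : s ⊆ s.image Prod.fst ×ˢ s.image Prod.snd := fun p hp =>
        Finset.mem_product.2 ⟨Finset.mem_image_of_mem _ hp, Finset.mem_image_of_mem _ hp⟩
      refine (Finset.sum_le_sum_of_subset_of_nonneg hsub fun _ _ _ => by positivity).trans ?_
      rw [Finset.sum_product_right, mul_pow]
      refine le_trans ?_ (mul_le_mul_of_nonneg_left (sum_slice x (s.image Prod.snd))
        (by positivity))
      rw [Finset.mul_sum]
      refine Finset.sum_le_sum fun c _ => ?_
      rw [← mul_pow]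
      refine le_trans ?_ (pow_le_pow_left₀ (norm_nonneg _) (X.le_opNorm (slice c x)) 2)
      have hs := hasSum_normSq (X (slice c x))
      have := hs.summable.sum_le_tsum (s.image Prod.fst) fun _ _ => by positivity
      rw [hs.tsum_eq] at this
      simpa [inner_ket] using this)

theorem entry_tensorOne {ι κ : Type} [DecidableEq κ] (X : Op ι) (a b : ι) (c d : κ) :
    entry (tensorOne κ X) (a, c) (b, d) = if c = d then entry X a b else 0 := by
  classical
  change ⟪ket (a, c), tensorOne κ X (ket (b, d))⟫_ℂ = _
  rw [inner_ket]
  change ⟪ket a, X (slice c (ket (b, d)))⟫_ℂ = _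
  have h : slice c (ket (b, d) : Hilb (ι × κ)) = if c = d then ket b else 0 := by
    ext a'
    change (ket (b, d) : Hilb (ι × κ)) (a', c) = _
    rw [ket_apply]
    split_ifs <;> simp_all [ket_apply]
  rw [h]
  split_ifs
  · rfl
  · simp

/-- `Y` is the operator `⨂ j, X j` on an `n`-partite system. -/
def IsTensor {n : ℕ} {I : Fin n → Type} (X : ∀ j, Op (I j)) (Y : Op (∀ j, I j)) : Prop :=
  ∀ a b, entry Y a b = ∏ j, entry (X j) (a j) (b j)

/-! ### Trace class operators and states -/

/-- The trace; meant for trace class operators, for which the series converges absolutely. -/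
def tr {ι : Type} (X : Op ι) : ℂ := ∑' a, entry X a a

/-- The trace class operators: the linear span of the positive operators of finite trace. -/
def traceClass (ι : Type) : Submodule ℂ (Op ι) :=
  Submodule.span ℂ {P | P.IsPositive ∧ Summable fun a => entry P a a}

abbrev TC (ι : Type) : Type := traceClass ι

/-- Density operators. -/
def IsState {ι : Type} (ρ : Op ι) : Prop :=
  ρ.IsPositive ∧ HasSum (fun a => entry ρ a a) 1

theorem rankOne_self_mem {ι : Type} (u : Hilb ι) :
    InnerProductSpace.rankOne ℂ u u ∈ traceClass ι := by
  refine Submodule.subset_span ⟨InnerProductSpace.isPositive_rankOne_self u, ?_⟩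
  have h := (hasSum_normSq u).summable
  have h' : Summable fun a => ((‖u a‖ ^ 2 : ℝ) : ℂ) := Complex.ofRealCLM.summable h
  refine h'.congr fun a => ?_
  change _ = ⟪ket a, _⟫_ℂ
  rw [InnerProductSpace.inner_right_rankOne_apply, inner_ket, ← inner_conj_symm u, inner_ket,
    Complex.mul_conj, Complex.normSq_eq_norm_sq]

theorem rankOne_mem {ι : Type} (u w : Hilb ι) :
    InnerProductSpace.rankOne ℂ u w ∈ traceClass ι := by
  have key : InnerProductSpace.rankOne ℂ u w = (1 / 4 : ℂ) •
      (InnerProductSpace.rankOne ℂ (u + w) (u + w) - InnerProductSpace.rankOne ℂ (u - w) (u - w)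
        + Complex.I • InnerProductSpace.rankOne ℂ (u + Complex.I • w) (u + Complex.I • w)
        - Complex.I • InnerProductSpace.rankOne ℂ (u - Complex.I • w) (u - Complex.I • w)) := by
    refine ContinuousLinearMap.ext fun z => ?_
    simp only [smul_apply, add_apply, sub_apply,
      InnerProductSpace.rankOne_apply, inner_add_left,
      inner_sub_left, inner_smul_left, Complex.conj_I]
    match_scalars
    · linear_combination (1 / 2 * ⟪w, z⟫_ℂ) * Complex.I_sq
    · linear_combination (-(1 / 2) * ⟪u, z⟫_ℂ) * Complex.I_sq
  rw [key]
  refine Submodule.smul_mem _ _ (Submodule.sub_mem _ (Submodule.add_mem _ (Submodule.sub_mem _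
    (rankOne_self_mem _) (rankOne_self_mem _)) (Submodule.smul_mem _ _ (rankOne_self_mem _)))
    (Submodule.smul_mem _ _ (rankOne_self_mem _)))

/-- The trace class operator `|u⟩⟨w|`. -/
def ketbra {ι : Type} (u w : Hilb ι) : TC ι := ⟨InnerProductSpace.rankOne ℂ u w, rankOne_mem u w⟩

/-! ### Channels -/

/-- A matrix of operators is positive as an operator on `ℂᵐ ⊗ H`. -/
def BlockPositive {ι : Type} {m : ℕ} (X : Fin m → Fin m → Op ι) : Prop :=
  ∀ v : Fin m → Hilb ι, 0 ≤ ∑ i, ∑ j, ⟪v i, X i j (v j)⟫_ℂ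

/-- Complete positivity: `id ⊗ Φ` is positive for every finite-dimensional ancilla. -/
def IsCP {ι κ : Type} (Φ : TC ι →ₗ[ℂ] TC κ) : Prop :=
  ∀ (m : ℕ) (X : Fin m → Fin m → TC ι),
    BlockPositive (fun i j => (X i j : Op ι)) → BlockPositive (fun i j => (Φ (X i j) : Op κ))

def IsTP {ι κ : Type} (Φ : TC ι →ₗ[ℂ] TC κ) : Prop :=
  ∀ X : TC ι, tr (Φ X : Op κ) = tr (X : Op ι)

/-- Quantum channels: completely positive trace preserving maps. -/
def IsChannel {ι κ : Type} (Φ : TC ι →ₗ[ℂ] TC κ) : Prop := IsCP Φ ∧ IsTP Φ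

/-! ### LOCC channels -/

/-- `G` acts on product operators as the tensor product of the local maps `L j`.  A completely
positive `G` is determined by this property. -/
def IsProductMap {n : ℕ} {I M : Fin n → Type} (L : ∀ j, TC (I j) →ₗ[ℂ] TC (M j))
    (G : TC (∀ j, I j) →ₗ[ℂ] TC (∀ j, M j)) : Prop :=
  ∀ (X : ∀ j, TC (I j)) (Y : TC (∀ j, I j)),
    IsTensor (fun j => (X j : Op (I j))) (Y : Op (∀ j, I j)) →
      IsTensor (fun j => (L j (X j) : Op (M j))) (G Y : Op (∀ j, M j))

/-- Channels realised by a protocol of local operations and classical communication in which every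
run ends after finitely many rounds.  In a round, party `k` performs a local instrument with
outcomes `x : ℕ` (some of which may never occur), broadcasts the outcome, and the other parties
apply local channels that may depend on `x`; the intermediate local systems `M x j` are arbitrary.
The rest of the protocol may depend on `x`.  At the end the parties apply local channels. -/
inductive LOCCProtocol {n : ℕ} {I' : Fin n → Type} :
    ∀ {I : Fin n → Type}, (TC (∀ j, I j) →ₗ[ℂ] TC (∀ j, I' j)) → Prop
  | final {I : Fin n → Type} (L : ∀ j, TC (I j) →ₗ[ℂ] TC (I' j)) (hL : ∀ j, IsChannel (L j))
      (Λ : TC (∀ j, I j) →ₗ[ℂ] TC (∀ j, I' j)) (hΛ : IsChannel Λ) (hprod : IsProductMap L Λ) :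
      LOCCProtocol Λ
  | round {I : Fin n → Type} (k : Fin n) (M : ℕ → Fin n → Type)
      (hM : ∀ x j, Countable (M x j))
      (L : ∀ x j, TC (I j) →ₗ[ℂ] TC (M x j)) (hCP : ∀ x j, IsCP (L x j))
      (hTP : ∀ x j, j ≠ k → IsTP (L x j))
      (hinstr : ∀ X : TC (I k),
        HasSum (fun x => tr (L x k X : Op (M x k))) (tr (X : Op (I k))))
      (G : ∀ x, TC (∀ j, I j) →ₗ[ℂ] TC (∀ j, M x j)) (hG : ∀ x, IsCP (G x))
      (hprod : ∀ x, IsProductMap (L x) (G x))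
      (Φ : ∀ x, TC (∀ j, M x j) →ₗ[ℂ] TC (∀ j, I' j)) (hΦ : ∀ x, LOCCProtocol (Φ x))
      (Λ : TC (∀ j, I j) →ₗ[ℂ] TC (∀ j, I' j)) (hΛ : IsChannel Λ)
      (hsum : ∀ (X : TC (∀ j, I j)) (u w : Hilb (∀ j, I' j)),
        HasSum (fun x => ⟪u, (Φ x (G x X) : Op (∀ j, I' j)) w⟫_ℂ)
          ⟪u, (Λ X : Op (∀ j, I' j)) w⟫_ℂ) :
      LOCCProtocol Λ

/-- LOCC channels: the channels that are limits of LOCC protocols, pointwise on trace class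
operators.  (For states, weak convergence to a state and convergence in trace norm coincide.)
Limits account for protocols with infinitely many rounds or with continuous messages. -/
def IsLOCC {n : ℕ} {I I' : Fin n → Type} (Λ : TC (∀ j, I j) →ₗ[ℂ] TC (∀ j, I' j)) : Prop :=
  IsChannel Λ ∧ ∃ S : ℕ → (TC (∀ j, I j) →ₗ[ℂ] TC (∀ j, I' j)), (∀ r, LOCCProtocol (S r)) ∧
    ∀ (X : TC (∀ j, I j)) (u w : Hilb (∀ j, I' j)),
      Filter.Tendsto (fun r => ⟪u, (S r X : Op (∀ j, I' j)) w⟫_ℂ) Filter.atTop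
        (𝓝 ⟪u, (Λ X : Op (∀ j, I' j)) w⟫_ℂ)

/-! ### Partial transposition -/

/-- Partial transposition of a matrix on an `n`-partite system, over the parties in `J`. -/
def ptMatrix {n : ℕ} {I : Fin n → Type} (J : Finset (Fin n))
    (M : Matrix (∀ j, I j) (∀ j, I j) ℂ) : Matrix (∀ j, I j) (∀ j, I j) ℂ :=
  Matrix.of fun a b => M (J.piecewise b a) (J.piecewise a b)

/-- Partial transposition over the systems `A_j` and `A'_j`, `j ∈ J`, of a matrix on `A A'`. -/
def ptMatrix₂ {n : ℕ} {I I' : Fin n → Type} (J : Finset (Fin n))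
    (M : Matrix ((∀ j, I j) × (∀ j, I' j)) ((∀ j, I j) × (∀ j, I' j)) ℂ) :
    Matrix ((∀ j, I j) × (∀ j, I' j)) ((∀ j, I j) × (∀ j, I' j)) ℂ :=
  Matrix.of fun p q => M (J.piecewise q.1 p.1, J.piecewise q.2 p.2)
    (J.piecewise p.1 q.1, J.piecewise p.2 q.2)

/-- The partial transpose of a Hilbert--Schmidt operator on `A`. -/
def partialTranspose {n : ℕ} {I : Fin n → Type} (J : Finset (Fin n)) (X : Op (∀ j, I j)) :
    Op (∀ j, I j) := ofMatrix (ptMatrix J (entry X))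

/-- The partial transpose of a Hilbert--Schmidt operator on `A A'`. -/
def partialTranspose₂ {n : ℕ} {I I' : Fin n → Type} (J : Finset (Fin n))
    (X : Op ((∀ j, I j) × (∀ j, I' j))) : Op ((∀ j, I j) × (∀ j, I' j)) :=
  ofMatrix (ptMatrix₂ J (entry X))

/-- The partial trace over the second factor, for trace class operators. -/
def partialTrace {ι κ : Type} (X : Op (ι × κ)) : Op ι :=
  ofMatrix (Matrix.of fun a b => ∑' c, entry X (a, c) (b, c))

/-! ### PPT channels -/

/-- The matrix of the unnormalised Choi operator `∑ a b, |a⟩⟨b| ⊗ Λ(|a⟩⟨b|)`. -/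
def choi {ι κ : Type} (Λ : TC ι →ₗ[ℂ] TC κ) : Matrix (ι × κ) (ι × κ) ℂ :=
  Matrix.of fun p q => entry (Λ (ketbra (ket p.1) (ket q.1)) : Op κ) p.2 q.2

/-- PPT channels: every partial transpose of the Choi matrix is positive semidefinite.  On infinite
index types, `Matrix.PosSemidef` tests the quadratic form on vectors of finite support, that is, it
tests all finite truncations of the Choi operator. -/
def IsPPT {n : ℕ} {I I' : Fin n → Type} (Λ : TC (∀ j, I j) →ₗ[ℂ] TC (∀ j, I' j)) : Prop :=
  IsChannel Λ ∧ ∀ J : Finset (Fin n), (ptMatrix₂ J (choi Λ)).PosSemidef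

/-! ### Max-relative entropy and conditional min-entropy -/

/-- `d_max(X‖Y) = inf {λ > 0 : X ≤ λ Y}`, with value `∞` if there is no such `λ`. -/
def dmax {ι : Type} (X Y : Op ι) : ℝ≥0∞ :=
  ⨅ (l : ℝ) (_ : 0 < l ∧ X ≤ (l : ℂ) • Y), ENNReal.ofReal l

/-- The conditional min-entropy `H_min(A'|A)` of an operator on `A A'`. -/
def Hmin {ι κ : Type} (X : Op (ι × κ)) : EReal :=
  -ENNReal.log (⨅ (ξ : Op ι) (_ : IsState ξ), dmax X (tensorOne κ ξ))

/-! ### Ensembles and simulation fidelities -/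

/-- An ensemble of pure states, given by a random unit vector. -/
structure Ensemble (Ω : Type*) [MeasurableSpace Ω] (ι : Type) where
  μ : MeasureTheory.Measure Ω
  isProb : MeasureTheory.IsProbabilityMeasure μ
  ψ : Ω → Hilb ι
  meas : MeasureTheory.AEStronglyMeasurable ψ μ
  norm_one : ∀ α, ‖ψ α‖ = 1

/-- `∫ dμ(α) Tr[Λ(ψ_α) ψ'_α]` with `ψ'_α = U ψ_α U†`. -/
def avgFidelity {Ω : Type*} [MeasurableSpace Ω] {ι κ : Type} (E : Ensemble Ω ι)
    (U : Hilb ι →ₗᵢ[ℂ] Hilb κ) (Λ : TC ι →ₗ[ℂ] TC κ) : ℝ≥0∞ :=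
  ∫⁻ α, ENNReal.ofReal
    (tr ((Λ (ketbra (E.ψ α) (E.ψ α)) : Op κ) ∘L (ketbra (U (E.ψ α)) (U (E.ψ α)) : Op κ))).re ∂E.μ

/-- The LOCC simulation fidelity. -/
def loccFidelity {Ω : Type*} [MeasurableSpace Ω] {n : ℕ} {I I' : Fin n → Type}
    (E : Ensemble Ω (∀ j, I j)) (U : Hilb (∀ j, I j) →ₗᵢ[ℂ] Hilb (∀ j, I' j)) : ℝ≥0∞ :=
  ⨆ (Λ : TC (∀ j, I j) →ₗ[ℂ] TC (∀ j, I' j)) (_ : IsLOCC Λ), avgFidelity E U Λ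

/-- The PPT simulation fidelity. -/
def pptFidelity {Ω : Type*} [MeasurableSpace Ω] {n : ℕ} {I I' : Fin n → Type}
    (E : Ensemble Ω (∀ j, I j)) (U : Hilb (∀ j, I j) →ₗᵢ[ℂ] Hilb (∀ j, I' j)) : ℝ≥0∞ :=
  ⨆ (Λ : TC (∀ j, I j) →ₗ[ℂ] TC (∀ j, I' j)) (_ : IsPPT Λ), avgFidelity E U Λ

/-- `R = ∫ dμ(α) ψ_α^* ⊗ ψ'_α`, where `star` is the complex conjugate in the chosen basis. -/
def Rop {Ω : Type*} [MeasurableSpace Ω] {ι κ : Type} (E : Ensemble Ω ι)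
    (U : Hilb ι →ₗᵢ[ℂ] Hilb κ) : Op (ι × κ) :=
  ∫ α, InnerProductSpace.rankOne ℂ (tensorVec (star (E.ψ α)) (U (E.ψ α)))
    (tensorVec (star (E.ψ α)) (U (E.ψ α))) ∂E.μ

/-- Every vector of the ensemble is a product vector. -/
def Ensemble.IsProduct {Ω : Type*} [MeasurableSpace Ω] {n : ℕ} {I : Fin n → Type}
    (E : Ensemble Ω (∀ j, I j)) : Prop :=
  ∀ α, ∃ φ : ∀ j, Hilb (I j), (∀ j, ‖φ j‖ = 1) ∧ ∀ a, E.ψ α a = ∏ j, φ j (a j)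

/-- `exp[-H_min(A'|A)]` of the partial transpose of `R` over `J`. -/
def minEntropyBound {Ω : Type*} [MeasurableSpace Ω] {n : ℕ} {I I' : Fin n → Type}
    (E : Ensemble Ω (∀ j, I j)) (U : Hilb (∀ j, I j) →ₗᵢ[ℂ] Hilb (∀ j, I' j))
    (J : Finset (Fin n)) : ℝ≥0∞ :=
  EReal.exp (-Hmin (partialTranspose₂ J (Rop E U)))

/-- `d_max(R^{Γ_J} ‖ R_A^{Γ_J} ⊗ 1)`. -/
def productBound {Ω : Type*} [MeasurableSpace Ω] {n : ℕ} {I I' : Fin n → Type}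
    (E : Ensemble Ω (∀ j, I j)) (U : Hilb (∀ j, I j) →ₗᵢ[ℂ] Hilb (∀ j, I' j))
    (J : Finset (Fin n)) : ℝ≥0∞ :=
  dmax (partialTranspose₂ J (Rop E U))
    (tensorOne (∀ j, I' j) (partialTranspose J (partialTrace (Rop E U))))

end LOCCBound

end

open scoped ENNReal InnerProductSpace ComplexOrder Topology

noncomputable section

open MeasureTheory

namespace LOCCBound

/-! ### Positive semidefinite matrices over arbitrary index types -/

/-! Write C for the Choi operator of a channel and Γ for a partial transposition over some of the
parties. Expanding in matrix units, the average fidelity is Tr[R C]; the conjugate of ψ in R absorbs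
the transposition hidden in the Choi correspondence. Transposing both factors over the same parties
does not change the trace, so the fidelity is Tr[R^Γ C^Γ]. If C^Γ ≥ 0 and R^Γ ≤ κ ξ ⊗ 1, this is at
most κ Tr[ξ Tr_{A'} C^Γ] = κ, because trace preservation makes Tr_{A'} C^Γ the identity
(`sum_Rop_mul_choi_le`, `IsTP.hasSum_ptMatrix₂_choi`, `avgFidelity_le`).

In infinite dimension these traces are read on finite sets of basis labels. The sets are boxes,
since exchanging some coordinates of two multi-indices does not leave a box. The passage to the
limit rests on the weak continuity of channels under truncation (`IsChannel.tendsto_trunc`) and on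
Fatou's lemma.

LOCC channels are PPT. The Choi matrix of a product of local maps is a product of local Choi
matrices, and Γ merely transposes some factors, so Schur's product theorem applies. Composition of
maps is the link product of Choi matrices, a Hadamard product followed by a contraction of the
intermediate indices. Sums over outcomes and pointwise limits preserve positivity
(`LOCCProtocol.isPPT`, `IsLOCC.isPPT`).

Passing to the complement of J is a full transposition, which preserves the order and takes states
to states. For J = ∅, testing R ≤ κ ξ ⊗ 1 on truncations of ∑ |a⟩ ⊗ U|a⟩ forces κ ≥ 1
(`one_le_of_Rop_le`). For product ensembles the partial transpose of ψ* is again a product state,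
while that of ψ' has Hilbert–Schmidt norm one and so is at most the identity. Hence R_A^Γ is an
admissible ξ, and κ = 1 works for it (`partialTranspose₂_Rop_le`). -/

theorem posSemidef_iff_sum {ι : Type*} {M : Matrix ι ι ℂ} :
    M.PosSemidef ↔ ∀ (s : Finset ι) (v : ι → ℂ),
      0 ≤ ∑ a ∈ s, ∑ b ∈ s, star (v a) * M a b * v b := by
  classical
  constructor
  · intro h s v
    have h1 := h.2 (Finsupp.indicator s fun a _ => v a)
    have hsub := Finsupp.support_indicator_subset s (fun a _ => v a)
    rw [Finsupp.sum_of_support_subset _ hsub _ (by simp)] at h1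
    refine h1.trans_eq (Finset.sum_congr rfl fun a ha => ?_)
    rw [Finsupp.sum_of_support_subset _ hsub _ (by simp)]
    refine Finset.sum_congr rfl fun b hb => ?_
    rw [Finsupp.indicator_of_mem ha, Finsupp.indicator_of_mem hb]
  · intro h
    refine ⟨?_, fun x => h x.support x⟩
    have hd : ∀ a, (M a a).im = 0 := fun a => by
      have := (Complex.nonneg_iff.1 (h {a} fun _ => 1)).2
      simpa using this.symm
    ext a b
    rw [Matrix.conjTranspose_apply]
    by_cases hab : a = b
    · subst hab
      exact Complex.ext (by simp) (by simp [hd])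
    -- Polarization: the weights (1, 1) show that the imaginary parts of M a b and M b a are
    -- opposite, and the weights (1, i) that the real parts agree.
    have h1 := (Complex.nonneg_iff.1 (h {a, b} fun _ => 1)).2
    have h2 := (Complex.nonneg_iff.1 (h {a, b} fun c => if c = a then 1 else Complex.I)).2
    rw [Finset.sum_pair hab, Finset.sum_pair hab, Finset.sum_pair hab] at h1 h2
    simp [hd, Ne.symm hab] at h1 h2
    exact Complex.ext (by simp; linarith) (by simp; linarith)

/-- The finite form of Tr[A B] ≥ 0: Schur's product theorem for A and the transpose of B, tested on
the all-ones vector. -/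
theorem _root_.Matrix.PosSemidef.sum_mul_nonneg {ι : Type*} {A B : Matrix ι ι ℂ}
    (hA : A.PosSemidef) (hB : B.PosSemidef) (s : Finset ι) :
    0 ≤ ∑ a ∈ s, ∑ b ∈ s, A a b * B b a := by
  have := posSemidef_iff_sum.1 (hA.hadamard hB.transpose) s 1
  simpa using this

/-- Restricting the quadratic form to vectors that are constant in the second index contracts that
index; this is the contraction step of the link product. -/
theorem _root_.Matrix.PosSemidef.blockSum {ι μ : Type*} {K : Matrix (ι × μ) (ι × μ) ℂ}
    (hK : K.PosSemidef) (S : Finset μ) :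
    (Matrix.of fun p q => ∑ m ∈ S, ∑ m' ∈ S, K (p, m) (q, m')).PosSemidef := by
  refine posSemidef_iff_sum.2 fun s v => ?_
  refine (posSemidef_iff_sum.1 hK (s ×ˢ S) fun x => v x.1).trans_eq ?_
  simp only [Finset.sum_product, Matrix.of_apply, Finset.mul_sum, Finset.sum_mul]
  refine Finset.sum_congr rfl fun a _ => ?_
  rw [Finset.sum_comm]

theorem posSemidef_of_tendsto {ι β : Type*} {l : Filter β} [l.NeBot]
    {M : β → Matrix ι ι ℂ} {N : Matrix ι ι ℂ} (hM : ∀ x, (M x).PosSemidef)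
    (h : ∀ a b, Filter.Tendsto (fun x => M x a b) l (𝓝 (N a b))) : N.PosSemidef := by
  refine posSemidef_iff_sum.2 fun s v => ?_
  refine ge_of_tendsto' (f := fun x => ∑ a ∈ s, ∑ b ∈ s, star (v a) * M x a b * v b) (x := l)
    ?_ fun x => posSemidef_iff_sum.1 (hM x) s v
  exact tendsto_finsetSum _ fun a _ => tendsto_finsetSum _ fun b _ =>
    ((h a b).const_mul _).mul_const _

theorem posSemidef_sum {ι β : Type*} (t : Finset β) {M : β → Matrix ι ι ℂ}
    (hM : ∀ x, (M x).PosSemidef) : (∑ x ∈ t, M x).PosSemidef := by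
  classical
  induction t using Finset.induction_on with
  | empty => simpa using Matrix.PosSemidef.zero
  | insert x t hx ih => rw [Finset.sum_insert hx]; exact (hM x).add ih

theorem posSemidef_of_hasSum {ι β : Type*} {M : β → Matrix ι ι ℂ} {N : Matrix ι ι ℂ}
    (hM : ∀ x, (M x).PosSemidef) (h : ∀ a b, HasSum (fun x => M x a b) (N a b)) :
    N.PosSemidef :=
  posSemidef_of_tendsto (fun t => posSemidef_sum t hM) fun a b => by
    simpa [Matrix.sum_apply, HasSum] using h a b

theorem posSemidef_prod {ι β : Type*} (t : Finset β) {M : β → Matrix ι ι ℂ}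
    (hM : ∀ x, (M x).PosSemidef) : (Matrix.of fun a b => ∏ x ∈ t, M x a b).PosSemidef := by
  classical
  induction t using Finset.induction_on with
  | empty =>
    refine posSemidef_iff_sum.2 fun s v => ?_
    have : (0 : ℂ) ≤ star (∑ b ∈ s, v b) * ∑ b ∈ s, v b := star_mul_self_nonneg _
    simpa [star_sum, Finset.sum_mul_sum] using this
  | insert x t hx ih =>
    have e : (Matrix.of fun a b => ∏ y ∈ insert x t, M y a b) =
        (M x).hadamard (Matrix.of fun a b => ∏ y ∈ t, M y a b) := by
      ext a b
      simp [Finset.prod_insert hx]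
    rw [e]
    exact (hM x).hadamard ih

/-! ### Matrices of operators -/

theorem star_ket {ι : Type} (a : ι) : star (ket a : Hilb ι) = ket a := by
  classical
  ext b
  rw [lp.star_apply, ket_apply]
  split_ifs <;> simp

theorem hasSum_ket {ι : Type} (x : Hilb ι) : HasSum (fun a => x a • (ket a : Hilb ι)) x := by
  classical
  have h := lp.hasSum_single (p := 2) (by norm_num) x
  have e : (fun a => x a • (ket a : Hilb ι)) = fun a => lp.single 2 a (x a) := funext fun a => ?_
  · rwa [e]
  ext b
  rw [lp.coeFn_smul, Pi.smul_apply, ket_apply]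
  by_cases hb : b = a
  · subst hb; simp
  · simp [hb]

theorem entry_apply {ι : Type} (X : Op ι) (a b : ι) : entry X a b = X (ket b) a :=
  inner_ket a _

theorem entry_add {ι : Type} (X Y : Op ι) : entry (X + Y) = entry X + entry Y := by
  ext a b; simp [entry]

theorem entry_sub {ι : Type} (X Y : Op ι) : entry (X - Y) = entry X - entry Y := by
  ext a b; simp [entry]

theorem entry_smul {ι : Type} (c : ℂ) (X : Op ι) : entry (c • X) = c • entry X := by
  ext a b; simp [entry]

theorem op_ext {ι : Type} {X Y : Op ι} (h : entry X = entry Y) : X = Y := by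
  refine ContinuousLinearMap.ext fun x => ?_
  have hk : ∀ b, X (ket b) = Y (ket b) := fun b => by
    ext a
    simpa [entry_apply] using congrFun (congrFun h a) b
  have h1 := X.hasSum (hasSum_ket x)
  have h2 := Y.hasSum (hasSum_ket x)
  simp only [map_smul, hk] at h1 h2
  exact h1.unique h2

theorem inner_sum_ket {ι : Type} (X : Op ι) (s : Finset ι) (v w : ι → ℂ) :
    ⟪∑ a ∈ s, v a • (ket a : Hilb ι), X (∑ b ∈ s, w b • ket b)⟫_ℂ =
      ∑ a ∈ s, ∑ b ∈ s, star (v a) * entry X a b * w b := by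
  simp only [map_sum, map_smul, sum_inner, inner_sum, inner_smul_left, inner_smul_right, entry,
    Matrix.of_apply]
  simp only [Finset.mul_sum]
  rw [Finset.sum_comm]
  refine Finset.sum_congr rfl fun a _ => Finset.sum_congr rfl fun b _ => ?_
  rw [starRingEnd_apply]; ring

theorem tendsto_inner_trunc {ι : Type} (X : Op ι) (x y : Hilb ι) :
    Filter.Tendsto (fun s : Finset ι => ∑ a ∈ s, ∑ b ∈ s, star (x a) * entry X a b * y b)
      Filter.atTop (𝓝 ⟪x, X y⟫_ℂ) := by
  simp only [← inner_sum_ket]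
  exact (hasSum_ket x).inner ((X.continuous.tendsto y).comp (hasSum_ket y))

/-- Vectors of finite support are dense and X is bounded, so testing on them loses nothing. Operator
inequalities thereby become statements about matrices. -/
theorem posSemidef_entry_iff {ι : Type} {X : Op ι} : (entry X).PosSemidef ↔ X.IsPositive := by
  constructor
  · intro h
    have h0 : ∀ x, 0 ≤ ⟪x, X x⟫_ℂ := fun x =>
      ge_of_tendsto' (tendsto_inner_trunc X x x) fun s => posSemidef_iff_sum.1 h s x
    rw [ContinuousLinearMap.isPositive_iff_complex]
    intro x
    have h1 := h0 x
    have h2 := Complex.nonneg_iff.1 h1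
    rw [← inner_conj_symm]
    generalize ⟪x, X x⟫_ℂ = z at h2
    exact ⟨Complex.ext (by simp) (by simp [← h2.2]), by simpa using h2.1⟩
  · intro h
    refine posSemidef_iff_sum.2 fun s v => ?_
    rw [← inner_sum_ket]
    exact h.inner_nonneg_right _

theorem le_iff_entry {ι : Type} {X Y : Op ι} : X ≤ Y ↔ (entry Y - entry X).PosSemidef := by
  rw [ContinuousLinearMap.le_def, ← posSemidef_entry_iff, entry_sub]

theorem entry_rankOne {ι : Type} (u w : Hilb ι) (a b : ι) :
    entry (InnerProductSpace.rankOne ℂ u w) a b = u a * star (w b) := by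
  change ⟪ket a, _⟫_ℂ = _
  rw [InnerProductSpace.inner_right_rankOne_apply, inner_ket, ← inner_conj_symm w, inner_ket]
  rfl

theorem entry_ofMatrix {ι : Type} {M : Matrix ι ι ℂ} (hM : IsHSMatrix M) :
    entry (ofMatrix M) = M := by
  rw [ofMatrix, dif_pos hM, entry_hsOp]

/-! ### Complex conjugation and ampliation of positive operators -/

/-- The complex conjugate of an operator in the chosen basis. -/
def conjOp {ι : Type} (X : Op ι) : Op ι :=
  ((starL ℂ : Hilb ι ≃L⋆[ℂ] Hilb ι) : Hilb ι →L⋆[ℂ] Hilb ι).comp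
    (X.comp ((starL ℂ : Hilb ι ≃L⋆[ℂ] Hilb ι) : Hilb ι →L⋆[ℂ] Hilb ι))

theorem entry_conjOp {ι : Type} (X : Op ι) (a b : ι) :
    entry (conjOp X) a b = star (entry X a b) := by
  rw [entry_apply, entry_apply]
  change (star (X (star (ket b)))) a = _
  rw [star_ket, lp.star_apply]

/-- By Hermiticity, conjugation coincides with transposition here, and it is visibly bounded; it
thus supplies the operator with the transposed matrix. -/
theorem entry_conjOp_of_isPositive {ι : Type} {X : Op ι} (hX : X.IsPositive) :
    entry (conjOp X) = (entry X).transpose := by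
  have h := (posSemidef_entry_iff.2 hX).isHermitian
  ext a b
  rw [entry_conjOp, Matrix.transpose_apply, h.apply]

theorem IsState.conjOp {ι : Type} {ξ : Op ι} (h : IsState ξ) : IsState (conjOp ξ) := by
  refine ⟨posSemidef_entry_iff.1 ?_, ?_⟩
  · rw [entry_conjOp_of_isPositive h.1]
    exact (posSemidef_entry_iff.2 h.1).transpose
  · rw [entry_conjOp_of_isPositive h.1]
    simpa using h.2

theorem tensorOne_isPositive {ι κ : Type} {X : Op ι} (hX : X.IsPositive) :
    (tensorOne κ X).IsPositive := by
  classical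
  rw [← posSemidef_entry_iff]
  have e : entry (tensorOne κ X) = ((entry X).submatrix Prod.fst Prod.fst).hadamard
      ((1 : Matrix κ κ ℂ).submatrix Prod.snd Prod.snd) := by
    ext ⟨a, c⟩ ⟨b, d⟩
    rw [entry_tensorOne]
    simp [Matrix.one_apply]
  rw [e]
  exact ((posSemidef_entry_iff.2 hX).submatrix (Prod.fst : ι × κ → ι)).hadamard
    ((Matrix.PosSemidef.one (n := κ) (R := ℂ)).submatrix (Prod.snd : ι × κ → κ))

/-! ### Trace class operators and truncations -/

theorem summable_entry_diag {ι : Type} (X : TC ι) : Summable fun a => entry (X : Op ι) a a := by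
  obtain ⟨X, hX⟩ := X
  induction hX using Submodule.span_induction with
  | mem x h => exact h.2
  | zero => simp [entry]
  | add x y hx hy h1 h2 => simpa [entry_add] using h1.add h2
  | smul c x hx h => simpa [entry_smul] using h.mul_left c

theorem tr_sub {ι : Type} (X Y : TC ι) :
    tr ((X - Y : TC ι) : Op ι) = tr (X : Op ι) - tr (Y : Op ι) := by
  have := (summable_entry_diag X).tsum_sub (summable_entry_diag Y)
  simpa [tr, entry_sub] using this

theorem hasSum_re_tr {ι : Type} (X : TC ι) :
    HasSum (fun a => (entry (X : Op ι) a a).re) (tr (X : Op ι)).re :=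
  Complex.hasSum_re (summable_entry_diag X).hasSum

theorem exists_isPositive_mul_self {H : Type*} [NormedAddCommGroup H] [InnerProductSpace ℂ H]
    [CompleteSpace H] {X : H →L[ℂ] H} (hX : X.IsPositive) :
    ∃ S : H →L[ℂ] H, S.IsPositive ∧ S * S = X :=
  ⟨CFC.sqrt X, (ContinuousLinearMap.nonneg_iff_isPositive _).1 (CFC.sqrt_nonneg _),
    CFC.sqrt_mul_sqrt_self X ((ContinuousLinearMap.nonneg_iff_isPositive _).2 hX)⟩

/-- A positive operator is bounded by its trace. -/
theorem inner_le_tr {ι : Type} (X : TC ι) (hX : (X : Op ι).IsPositive) (u : Hilb ι) :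
    (⟪u, (X : Op ι) u⟫_ℂ).re ≤ ‖u‖ ^ 2 * (tr (X : Op ι)).re := by
  obtain ⟨S, hpos, hSS⟩ := exists_isPositive_mul_self hX
  have hq : ∀ x, (⟪x, (X : Op ι) x⟫_ℂ).re = ‖S x‖ ^ 2 := fun x => by
    rw [← hSS, mul_apply_eq_comp, ← hpos.inner_left_eq_inner_right,
      inner_self_eq_norm_sq_to_K]
    norm_cast
  rw [hq]
  have h1 : ∀ a, (entry (X : Op ι) a a).re = ‖S (ket a)‖ ^ 2 := fun a => hq (ket a)
  have h2 := (hasSum_re_tr X).mul_left (‖u‖ ^ 2)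
  refine hasSum_le (fun a => ?_) (hasSum_normSq (S u)) h2
  rw [h1, ← mul_pow]
  refine pow_le_pow_left₀ (norm_nonneg _) ?_ 2
  rw [← inner_ket, ← hpos.inner_left_eq_inner_right, mul_comm]
  exact norm_inner_le_norm _ _

theorem ket_inner_ket {ι : Type} [DecidableEq ι] (a b : ι) :
    ⟪(ket a : Hilb ι), ket b⟫_ℂ = if a = b then 1 else 0 := by
  rw [inner_ket, ket_apply]

/-- The truncation `P T P` of an operator to finitely many basis vectors. -/
def trunc {ι : Type} (s : Finset ι) : Op ι →ₗ[ℂ] TC ι where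
  toFun T := ∑ a ∈ s, ∑ b ∈ s, entry T a b • ketbra (ket a) (ket b)
  map_add' X Y := by simp [entry_add, add_smul, Finset.sum_add_distrib]
  map_smul' c X := by simp [entry_smul, mul_smul, Finset.smul_sum]

theorem entry_sum {ι β : Type} (s : Finset β) (X : β → Op ι) :
    entry (∑ x ∈ s, X x) = ∑ x ∈ s, entry (X x) := by
  ext a b
  simp [entry, Matrix.sum_apply]

theorem entry_trunc {ι : Type} [DecidableEq ι] (s : Finset ι) (T : Op ι) (a b : ι) :
    entry (trunc s T : Op ι) a b = if a ∈ s ∧ b ∈ s then entry T a b else 0 := by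
  have h : (trunc s T : Op ι) = ∑ c ∈ s, ∑ d ∈ s,
      entry T c d • InnerProductSpace.rankOne ℂ (ket c) (ket d) := by
    simp [trunc, ketbra]
  rw [h]
  simp only [entry_sum, entry_smul, Matrix.sum_apply, Matrix.smul_apply, entry_rankOne, ket_apply,
    smul_eq_mul]
  by_cases ha : a ∈ s <;> by_cases hb : b ∈ s <;> simp [ha, hb]

/-- The compression of an operator to the complement of finitely many basis vectors. -/
def cotrunc {ι : Type} (s : Finset ι) (T : Op ι) : Op ι :=
  let Q : Op ι := 1 - ∑ a ∈ s, InnerProductSpace.rankOne ℂ (ket a) (ket a)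
  Q ∘L T ∘L Q

theorem entry_cotrunc {ι : Type} [DecidableEq ι] (s : Finset ι) (T : Op ι) (a b : ι) :
    entry (cotrunc s T) a b = if a ∉ s ∧ b ∉ s then entry T a b else 0 := by
  set Q : Op ι := 1 - ∑ a ∈ s, InnerProductSpace.rankOne ℂ (ket a) (ket a) with hQ
  have hk : ∀ c, Q (ket c) = if c ∈ s then 0 else ket c := fun c => by
    simp only [hQ, sub_apply, one_apply_eq_self, sum_apply,
      InnerProductSpace.rankOne_apply, ket_inner_ket]
    split_ifs with h <;> simp [h]
  have hadj : ∀ y, (Q y) a = if a ∈ s then 0 else y a := fun y => by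
    have h1 : ⟪(ket a : Hilb ι), Q y⟫_ℂ = ⟪Q (ket a), y⟫_ℂ := by
      simp only [hQ, sub_apply, one_apply_eq_self, sum_apply,
        InnerProductSpace.rankOne_apply, inner_sub_left, inner_sub_right, inner_sum, sum_inner,
        inner_smul_left, inner_smul_right, inner_conj_symm, mul_comm]
    rw [← inner_ket, h1, hk]
    split_ifs <;> simp [inner_ket]
  rw [entry_apply, entry_apply]
  change (Q (T (Q (ket b)))) a = _
  rw [hadj, hk]
  by_cases ha : a ∈ s <;> by_cases hb : b ∈ s <;> simp [ha, hb]

/-- Congruence by a real diagonal matrix. Weights 0 and 1 give compressions to blocks; weights of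
opposite sign on two blocks control the off-diagonal part. -/
theorem hadamard_weight_posSemidef {ι : Type} {M : Matrix ι ι ℂ} (hM : M.PosSemidef) (c : ι → ℝ) :
    (Matrix.of fun a b => (c a : ℂ) * c b * M a b).PosSemidef := by
  refine posSemidef_iff_sum.2 fun s v => ?_
  refine (posSemidef_iff_sum.1 hM s fun a => c a * v a).trans_eq ?_
  refine Finset.sum_congr rfl fun a _ => Finset.sum_congr rfl fun b _ => ?_
  simp
  ring

theorem trunc_isPositive {ι : Type} (s : Finset ι) {T : Op ι} (hT : T.IsPositive) :
    (trunc s T : Op ι).IsPositive := by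
  classical
  rw [← posSemidef_entry_iff]
  have := hadamard_weight_posSemidef (posSemidef_entry_iff.2 hT) fun a => if a ∈ s then 1 else 0
  convert this using 1
  ext a b
  rw [entry_trunc]
  by_cases ha : a ∈ s <;> by_cases hb : b ∈ s <;> simp [ha, hb]

theorem cotrunc_isPositive {ι : Type} (s : Finset ι) {T : Op ι} (hT : T.IsPositive) :
    (cotrunc s T : Op ι).IsPositive := by
  classical
  rw [← posSemidef_entry_iff]
  have := hadamard_weight_posSemidef (posSemidef_entry_iff.2 hT) fun a => if a ∈ s then 0 else 1
  convert this using 1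
  ext a b
  rw [entry_cotrunc]
  by_cases ha : a ∈ s <;> by_cases hb : b ∈ s <;> simp [ha, hb]

theorem cotrunc_mem {ι : Type} (s : Finset ι) (T : TC ι) (hT : (T : Op ι).IsPositive) :
    cotrunc s (T : Op ι) ∈ traceClass ι := by
  classical
  refine Submodule.subset_span ⟨cotrunc_isPositive s hT, ?_⟩
  have := (summable_entry_diag T).indicator {a | a ∉ s}
  refine this.congr fun a => ?_
  rw [entry_cotrunc]
  by_cases ha : a ∈ s <;> simp [ha]

/-- A positive functional on trace class operators that is bounded by the trace is determined by
its values on finite truncations. -/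
theorem tendsto_trunc_of_isPositive {ι : Type} (f : TC ι →ₗ[ℂ] ℂ) (C : ℝ) (hC : 0 ≤ C)
    (hf : ∀ T : TC ι, (T : Op ι).IsPositive → 0 ≤ f T)
    (hfC : ∀ T : TC ι, (T : Op ι).IsPositive → (f T).re ≤ C * (tr (T : Op ι)).re)
    (T : TC ι) (hT : (T : Op ι).IsPositive) :
    Filter.Tendsto (fun s : Finset ι => f (trunc s (T : Op ι))) Filter.atTop (𝓝 (f T)) := by
  classical
  have hre : ∀ X : TC ι, (X : Op ι).IsPositive → f X = ((f X).re : ℂ) := fun X hX =>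
    Complex.ext rfl (Complex.nonneg_iff.1 (hf X hX)).2.symm
  rw [hre T hT, show (fun s : Finset ι => f (trunc s (T : Op ι))) =
    fun s => (((f (trunc s (T : Op ι))).re : ℝ) : ℂ) from
      funext fun s => hre _ (trunc_isPositive s hT)]
  refine (Complex.continuous_ofReal.tendsto _).comp ?_
  have hsumT := hasSum_re_tr T
  set t := (tr (T : Op ι)).re with ht
  let τ : Finset ι → ℝ := fun s => ∑ a ∈ s, (entry (T : Op ι) a a).re
  have hdiag : ∀ a, 0 ≤ (entry (T : Op ι) a a).re := fun a =>
    (Complex.nonneg_iff.1 (posSemidef_entry_iff.2 hT).diag_nonneg).1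
  have hτ : Filter.Tendsto τ Filter.atTop (𝓝 t) := hsumT
  have hτle : ∀ s, τ s ≤ t := fun s => sum_le_hasSum s (fun a _ => hdiag a) hsumT
  let Z : Finset ι → TC ι := fun s => ⟨cotrunc s (T : Op ι), cotrunc_mem s T hT⟩
  have htrunc : ∀ s, (tr (trunc s (T : Op ι) : Op ι)).re = τ s := fun s => by
    refine (hasSum_re_tr _).unique ?_
    have := hasSum_sum_of_ne_finset_zero (f := fun a => (entry (trunc s (T : Op ι) : Op ι) a a).re)
      (s := s) (L := .unconditional ι) (fun a ha => by simp [entry_trunc, ha])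
    convert this using 1
    exact Finset.sum_congr rfl fun a ha => by simp [entry_trunc, ha]
  have hZ : ∀ s, (tr (Z s : Op ι)).re = t - τ s := fun s => by
    rw [← htrunc, ht, ← Complex.sub_re, ← tr_sub]
    congr 1
    refine tsum_congr fun a => ?_
    rw [Submodule.coe_sub, entry_sub, Matrix.sub_apply, entry_trunc]
    change entry (cotrunc s _) a a = _
    rw [entry_cotrunc]
    by_cases ha : a ∈ s <;> simp [ha]
  -- Write T as a block P on s, a block Z off s and an off-diagonal rest X. Congruence with weights
  -- √e on s and ±1/√e off s gives e P + e⁻¹ Z ± X ≥ 0, so f(X) is dominated by e f(P) + e⁻¹ f(Z).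
  have key : ∀ s, ∀ e : ℝ, 0 < e →
      |(f T).re - (f (trunc s (T : Op ι))).re - (f (Z s)).re| ≤
        e * (f (trunc s (T : Op ι))).re + e⁻¹ * (f (Z s)).re := by
    intro s e he
    have hpos : ∀ σ : ℝ, σ = 1 ∨ σ = -1 → 0 ≤ e * (f (trunc s (T : Op ι))).re
        + e⁻¹ * (f (Z s)).re
        + σ * ((f T).re - (f (trunc s (T : Op ι))).re - (f (Z s)).re) := by
      intro σ hσ
      have h1 : (((e : ℂ) • trunc s (T : Op ι) + ((e⁻¹ : ℝ) : ℂ) • Z s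
          + (σ : ℂ) • (T - trunc s (T : Op ι) - Z s) : TC ι) : Op ι).IsPositive := by
        rw [← posSemidef_entry_iff]
        have := hadamard_weight_posSemidef (posSemidef_entry_iff.2 hT)
          fun a => if a ∈ s then √e else σ * (√e)⁻¹
        convert this using 1
        ext a b
        have hz : entry (Z s : Op ι) a b = if a ∉ s ∧ b ∉ s then entry (T : Op ι) a b else 0 :=
          entry_cotrunc s _ a b
        have hs : (√e : ℂ) * √e = e := by exact_mod_cast Real.mul_self_sqrt he.le
        have hs0 : (√e : ℂ) ≠ 0 := by exact_mod_cast (Real.sqrt_pos.2 he).ne'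
        have hσ2 : (σ : ℂ) * σ = 1 := by rcases hσ with rfl | rfl <;> simp
        simp only [Submodule.coe_add, Submodule.coe_sub, Submodule.coe_smul, entry_add, entry_sub,
          entry_smul, Matrix.add_apply, Matrix.sub_apply, Matrix.smul_apply, entry_trunc, hz,
          Matrix.of_apply, smul_eq_mul]
        by_cases ha : a ∈ s <;> by_cases hb : b ∈ s <;> simp [ha, hb] <;> left
        · rw [hs]
        · field_simp
        · field_simp
        · rw [← hs]
          field_simp
          linear_combination -hσ2
      have h2 := (Complex.nonneg_iff.1 (hf _ h1)).1
      simpa using h2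
    have h1 := hpos 1 (Or.inl rfl)
    have h2 := hpos (-1) (Or.inr rfl)
    rw [abs_le]
    constructor <;> linarith
  have hbound : ∀ s, ∀ e : ℝ, 0 < e →
      |(f (trunc s (T : Op ι))).re - (f T).re| ≤ e * (C * t) + (1 + e⁻¹) * (C * (t - τ s)) := by
    intro s e he
    have h1 := key s e he
    have hP := trunc_isPositive s hT
    have hZp : (Z s : Op ι).IsPositive := cotrunc_isPositive s hT
    have h2 := hfC _ hP
    have h3 := hfC _ hZp
    have h4 := (Complex.nonneg_iff.1 (hf _ hZp)).1
    rw [htrunc] at h2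
    rw [hZ] at h3
    have h5 : (f (trunc s (T : Op ι))).re ≤ C * t := h2.trans (by gcongr; exact hτle s)
    have h6 : e * (f (trunc s (T : Op ι))).re ≤ e * (C * t) := by gcongr
    have h7 : e⁻¹ * (f (Z s)).re ≤ e⁻¹ * (C * (t - τ s)) := by gcongr
    rw [abs_le] at h1 ⊢
    constructor <;> linarith [h1.1, h1.2]
  have ht0 : 0 ≤ t := hsumT.nonneg hdiag
  rw [Metric.tendsto_nhds]
  intro δ hδ
  -- The term with τ tends to 0 for fixed e, so e need only satisfy e C t < δ; the added 1 avoids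
  -- division by zero.
  set e := δ / (2 * (C * t + 1)) with he
  have hCt : 0 ≤ C * t := by positivity
  have he0 : 0 < e := by positivity
  have hlim : Filter.Tendsto (fun s => e * (C * t) + (1 + e⁻¹) * (C * (t - τ s))) Filter.atTop
      (𝓝 (e * (C * t) + (1 + e⁻¹) * (C * (t - t)))) :=
    (((tendsto_const_nhds.sub hτ).const_mul C).const_mul _).const_add _
  have hlt : e * (C * t) + (1 + e⁻¹) * (C * (t - t)) < δ := by
    rw [sub_self, mul_zero, mul_zero, add_zero, he, div_mul_eq_mul_div, div_lt_iff₀ (by positivity)]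
    nlinarith
  filter_upwards [hlim.eventually_lt_const hlt] with s hs
  rw [Real.dist_eq]
  exact (hbound s e he0).trans_lt hs

/-! ### Positivity and weak continuity of channels -/

theorem IsCP.isPositive {ι κ : Type} {Φ : TC ι →ₗ[ℂ] TC κ} (hΦ : IsCP Φ) (T : TC ι)
    (hT : (T : Op ι).IsPositive) : (Φ T : Op κ).IsPositive := by
  have h := hΦ 1 (fun _ _ => T) fun v => by simpa using hT.inner_nonneg_right (v 0)
  rw [← posSemidef_entry_iff]
  refine posSemidef_iff_sum.2 fun s v => ?_
  rw [← inner_sum_ket]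
  simpa using h fun _ => ∑ a ∈ s, v a • ket a

/-- For fixed u the functional T ↦ ⟨u, Φ(T) u⟩ is positive, and trace preservation bounds it by ‖u‖²
Tr T on positive T, so its values are limits over truncations. Linearity extends this from positive
operators to their span, and polarization to different vectors u and w. -/
theorem IsChannel.tendsto_trunc {ι κ : Type} {Φ : TC ι →ₗ[ℂ] TC κ} (hΦ : IsChannel Φ)
    (T : TC ι) (u w : Hilb κ) :
    Filter.Tendsto (fun s : Finset ι => ⟪u, (Φ (trunc s (T : Op ι)) : Op κ) w⟫_ℂ) Filter.atTop
      (𝓝 ⟪u, (Φ T : Op κ) w⟫_ℂ) := by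
  have hdiag : ∀ (T : TC ι) (u : Hilb κ),
      Filter.Tendsto (fun s : Finset ι => ⟪(Φ (trunc s (T : Op ι)) : Op κ) u, u⟫_ℂ) Filter.atTop
      (𝓝 ⟪(Φ T : Op κ) u, u⟫_ℂ) := by
    intro T u
    suffices h : Filter.Tendsto (fun s : Finset ι => ⟪u, (Φ (trunc s (T : Op ι)) : Op κ) u⟫_ℂ)
        Filter.atTop (𝓝 ⟪u, (Φ T : Op κ) u⟫_ℂ) by
      have h' := (Complex.continuous_conj.tendsto _).comp h
      simpa [Function.comp_def] using h'
    let f : TC ι →ₗ[ℂ] ℂ :=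
      { toFun := fun T => ⟪u, (Φ T : Op κ) u⟫_ℂ
        map_add' := fun X Y => by simp
        map_smul' := fun c X => by simp }
    have hf : ∀ T : TC ι, (T : Op ι).IsPositive → 0 ≤ f T := fun T hT =>
      (hΦ.1.isPositive T hT).inner_nonneg_right u
    have hfC : ∀ T : TC ι, (T : Op ι).IsPositive → (f T).re ≤ ‖u‖ ^ 2 * (tr (T : Op ι)).re :=
      fun T hT => by
        rw [← hΦ.2 T]
        exact inner_le_tr _ (hΦ.1.isPositive T hT) u
    change Filter.Tendsto (fun s : Finset ι => f (trunc s (T : Op ι))) Filter.atTop (𝓝 (f T))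
    obtain ⟨T, hT⟩ := T
    induction hT using Submodule.span_induction with
    | mem x h =>
      exact tendsto_trunc_of_isPositive f _ (by positivity) hf hfC ⟨x, Submodule.subset_span h⟩ h.1
    | zero =>
      have e : (⟨0, Submodule.zero_mem _⟩ : TC ι) = 0 := rfl
      simp [e]
    | add x y hx hy h1 h2 =>
      have e : (⟨x + y, Submodule.add_mem _ hx hy⟩ : TC ι) = ⟨x, hx⟩ + ⟨y, hy⟩ := rfl
      have := h1.add h2
      simpa only [e, map_add, Submodule.coe_add] using this
    | smul c x hx h =>
      have e : (⟨c • x, Submodule.smul_mem _ c hx⟩ : TC ι) = c • ⟨x, hx⟩ := rfl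
      have := h.const_mul c
      simpa only [e, map_smul, Submodule.coe_smul, smul_eq_mul] using this
  suffices h : Filter.Tendsto (fun s : Finset ι => ⟪(Φ (trunc s (T : Op ι)) : Op κ) w, u⟫_ℂ)
      Filter.atTop (𝓝 ⟪(Φ T : Op κ) w, u⟫_ℂ) by
    have h' := (Complex.continuous_conj.tendsto _).comp h
    simpa [Function.comp_def] using h'
  have hpol : ∀ S : TC κ, ⟪(S : Op κ) w, u⟫_ℂ = _ := fun S =>
    inner_map_polarization ((S : Op κ) : Hilb κ →ₗ[ℂ] Hilb κ) u w
  simp only [hpol]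
  exact ((((hdiag T _).sub (hdiag T _)).add ((hdiag T _).const_mul _)).sub
    ((hdiag T _).const_mul _)).div_const _

/-! ### LOCC channels are PPT -/

/-- Complete positivity is applied to the blocks |a_i⟩⟨a_j|, where (a_i, c_i) enumerates a finite
set of labels. The block matrix is positive because its form is |∑ ⟨a_j, w_j⟩|², and the image is
tested on the vectors v_i |c_i⟩. -/
theorem IsCP.choi_posSemidef {ι κ : Type} {Φ : TC ι →ₗ[ℂ] TC κ} (hΦ : IsCP Φ) :
    (choi Φ).PosSemidef := by
  refine posSemidef_iff_sum.2 fun s v => ?_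
  let e := s.equivFin.symm
  have h := hΦ s.card (fun i j => ketbra (ket (e i).1.1) (ket (e j).1.1)) (fun w => by
    have h1 : (0 : ℂ) ≤ star (∑ j, ⟪ket (e j).1.1, w j⟫_ℂ) * ∑ j, ⟪ket (e j).1.1, w j⟫_ℂ :=
      star_mul_self_nonneg _
    rw [star_sum, Finset.sum_mul_sum] at h1
    refine h1.trans_eq (Finset.sum_congr rfl fun i _ => Finset.sum_congr rfl fun j _ => ?_)
    change _ = ⟪w i, InnerProductSpace.rankOne ℂ _ _ (w j)⟫_ℂ
    rw [InnerProductSpace.inner_right_rankOne_apply, ← inner_conj_symm (w i)]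
    rfl) (fun i => v (e i).1 • ket (e i).1.2)
  refine h.trans_eq ?_
  have hsum : ∀ F : ι × κ → ℂ, ∑ i, F (e i).1 = ∑ p ∈ s, F p := fun F =>
    (e.sum_comp fun x => F x.1).trans (Finset.sum_coe_sort s F)
  rw [← hsum]
  refine Finset.sum_congr rfl fun i _ => ?_
  rw [← hsum]
  refine Finset.sum_congr rfl fun j _ => ?_
  simp only [map_smul, inner_smul_left, inner_smul_right, choi, entry, Matrix.of_apply]
  rw [starRingEnd_apply]
  ring

theorem prod_ket {n : ℕ} {I : Fin n → Type} (a b : ∀ j, I j) :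
    (ket a : Hilb (∀ j, I j)) b = ∏ j, (ket (a j) : Hilb (I j)) (b j) := by
  classical
  simp only [ket_apply, Finset.prod_ite_zero, Finset.mem_univ, true_imp_iff, Finset.prod_const_one,
    funext_iff]

theorem isTensor_ketbra {n : ℕ} {I : Fin n → Type} (a b : ∀ j, I j) :
    IsTensor (fun j => (ketbra (ket (a j)) (ket (b j)) : Op (I j)))
      (ketbra (ket a) (ket b) : Op (∀ j, I j)) := by
  intro c d
  simp only [ketbra, entry_rankOne, prod_ket, star_prod, Finset.prod_mul_distrib]

theorem IsProductMap.choi_eq {n : ℕ} {I M : Fin n → Type} {L : ∀ j, TC (I j) →ₗ[ℂ] TC (M j)}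
    {G : TC (∀ j, I j) →ₗ[ℂ] TC (∀ j, M j)} (h : IsProductMap L G)
    (p q : (∀ j, I j) × (∀ j, M j)) :
    choi G p q = ∏ j, choi (L j) (p.1 j, p.2 j) (q.1 j, q.2 j) :=
  h _ _ (isTensor_ketbra p.1 q.1) p.2 q.2

/-- The Choi matrix factorizes over the parties and the partial transposition transposes the factors
in J completely. Each factor stays positive, and Schur's product theorem reassembles them. -/
theorem IsProductMap.ptMatrix₂_choi_posSemidef {n : ℕ} {I M : Fin n → Type}
    {L : ∀ j, TC (I j) →ₗ[ℂ] TC (M j)} {G : TC (∀ j, I j) →ₗ[ℂ] TC (∀ j, M j)}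
    (h : IsProductMap L G) (hL : ∀ j, IsCP (L j)) (J : Finset (Fin n)) :
    (ptMatrix₂ J (choi G)).PosSemidef := by
  have e : ptMatrix₂ J (choi G) = Matrix.of fun p q => ∏ j,
      ((if j ∈ J then (choi (L j)).transpose else choi (L j)).submatrix
        (fun p : (∀ j, I j) × (∀ j, M j) => (p.1 j, p.2 j)) fun p => (p.1 j, p.2 j)) p q := by
    ext p q
    simp only [ptMatrix₂, Matrix.of_apply, h.choi_eq]
    refine Finset.prod_congr rfl fun j _ => ?_
    by_cases hj : j ∈ J <;> simp [hj]
  rw [e]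
  refine posSemidef_prod _ fun j => Matrix.PosSemidef.submatrix ?_ _
  split_ifs
  · exact (hL j).choi_posSemidef.transpose
  · exact (hL j).choi_posSemidef

/-! ### Coordinate swaps, finite boxes and link products -/

theorem piecewise_self {n : ℕ} {I : Fin n → Type} (J : Finset (Fin n)) (a : ∀ j, I j) :
    J.piecewise a a = a := by
  ext j
  by_cases hj : j ∈ J <;> simp [hj]

theorem piecewise_piecewise_swap {n : ℕ} {I : Fin n → Type} (J : Finset (Fin n))
    (a b : ∀ j, I j) : J.piecewise (J.piecewise a b) (J.piecewise b a) = a := by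
  ext j
  by_cases hj : j ∈ J <;> simp [hj]

/-- A sum over a finite box is invariant under swapping some coordinates of the two indices. -/
theorem sum_piFinset_piecewise {n : ℕ} {I : Fin n → Type} (J : Finset (Fin n))
    (S : ∀ j, Finset (I j)) (F : (∀ j, I j) → (∀ j, I j) → ℂ) :
    ∑ a ∈ Fintype.piFinset S, ∑ b ∈ Fintype.piFinset S, F (J.piecewise b a) (J.piecewise a b) =
      ∑ a ∈ Fintype.piFinset S, ∑ b ∈ Fintype.piFinset S, F a b := by
  rw [← Finset.sum_product', ← Finset.sum_product']
  have hmem : ∀ x ∈ Fintype.piFinset S ×ˢ Fintype.piFinset S,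
      (J.piecewise x.2 x.1, J.piecewise x.1 x.2) ∈ Fintype.piFinset S ×ˢ Fintype.piFinset S := by
    intro x hx
    simp only [Finset.mem_product, Fintype.mem_piFinset] at hx ⊢
    constructor <;> intro j <;> by_cases hj : j ∈ J <;> simp [hj, hx.1 j, hx.2 j]
  refine Finset.sum_nbij' (fun x => (J.piecewise x.2 x.1, J.piecewise x.1 x.2))
    (fun x => (J.piecewise x.2 x.1, J.piecewise x.1 x.2)) hmem hmem ?_ ?_ fun _ _ => rfl
  all_goals
    intro x _
    simp only [piecewise_piecewise_swap]

open Classical in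
/-- The sides of the smallest box that contains a finite set of multi-indices. -/
def boxSides {n : ℕ} {I : Fin n → Type} (s : Finset (∀ j, I j)) (j : Fin n) : Finset (I j) :=
  s.image fun a => a j

/-- A finite set lies in the box it spans, so boxes are cofinal and every limit over finite sets may
be taken along boxes only. -/
theorem tendsto_piFinset_boxSides {n : ℕ} (I : Fin n → Type) :
    Filter.Tendsto (fun s : Finset (∀ j, I j) => Fintype.piFinset (boxSides s)) Filter.atTop
      Filter.atTop := by
  classical
  refine Filter.tendsto_atTop_mono (fun s a ha => Fintype.mem_piFinset.2 fun j => ?_)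
    Filter.tendsto_id
  rw [boxSides, Finset.mem_image]
  exact ⟨a, ha, rfl⟩

/-- The partial transpose of a link product of Choi matrices, truncated to a finite box. -/
theorem linkProduct_posSemidef {n : ℕ} {I M I' : Fin n → Type} (J : Finset (Fin n))
    {A : Matrix ((∀ j, I j) × (∀ j, M j)) ((∀ j, I j) × (∀ j, M j)) ℂ}
    {B : Matrix ((∀ j, M j) × (∀ j, I' j)) ((∀ j, M j) × (∀ j, I' j)) ℂ}
    (hA : (ptMatrix₂ J A).PosSemidef) (hB : (ptMatrix₂ J B).PosSemidef)
    (S : ∀ j, Finset (M j)) :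
    (ptMatrix₂ J (Matrix.of fun p q => ∑ m ∈ Fintype.piFinset S, ∑ m' ∈ Fintype.piFinset S,
      A (p.1, m) (q.1, m') * B (m, p.2) (m', q.2))).PosSemidef := by
  have hK := (hA.submatrix fun x : ((∀ j, I j) × (∀ j, I' j)) × (∀ j, M j) => (x.1.1, x.2)).hadamard
    (hB.submatrix fun x : ((∀ j, I j) × (∀ j, I' j)) × (∀ j, M j) => (x.2, x.1.2))
  have h := Matrix.PosSemidef.blockSum hK (Fintype.piFinset S)
  have e : ptMatrix₂ J (Matrix.of fun p q => ∑ m ∈ Fintype.piFinset S,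
      ∑ m' ∈ Fintype.piFinset S, A (p.1, m) (q.1, m') * B (m, p.2) (m', q.2)) =
      Matrix.of fun p q => ∑ m ∈ Fintype.piFinset S, ∑ m' ∈ Fintype.piFinset S,
        (((ptMatrix₂ J A).submatrix (fun x : ((∀ j, I j) × (∀ j, I' j)) × (∀ j, M j) =>
          (x.1.1, x.2)) fun x => (x.1.1, x.2)).hadamard
        ((ptMatrix₂ J B).submatrix (fun x : ((∀ j, I j) × (∀ j, I' j)) × (∀ j, M j) =>
          (x.2, x.1.2)) fun x => (x.2, x.1.2))) (p, m) (q, m') := by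
    ext p q
    simp only [ptMatrix₂, Matrix.of_apply, Matrix.hadamard_apply, Matrix.submatrix_apply]
    -- The outer indices are already swapped along J; reindexing the box swaps the contracted
    -- indices m, m' as well, which turns both factors into partial transposes.
    rw [← sum_piFinset_piecewise J S]
  rw [e]
  exact h

theorem LOCCProtocol.isPPT {n : ℕ} {I I' : Fin n → Type}
    {Λ : TC (∀ j, I j) →ₗ[ℂ] TC (∀ j, I' j)} (h : LOCCProtocol Λ) : IsPPT Λ := by
  induction h with
  | final L hL Λ hΛ hprod => exact ⟨hΛ, hprod.ptMatrix₂_choi_posSemidef fun j => (hL j).1⟩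
  | round k M hM L hCP hTP hinstr G hG hprod Φ hΦ Λ hΛ hsum ih =>
    refine ⟨hΛ, fun J => ?_⟩
    -- Truncating the intermediate operator to a box turns the Choi matrix of the composition into a
    -- finite link product; weak continuity of the later channel removes the truncation.
    have hcomp : ∀ x, (ptMatrix₂ J (choi (Φ x ∘ₗ G x))).PosSemidef := fun x => by
      classical
      refine posSemidef_of_tendsto (β := Finset (∀ j, M x j)) (l := Filter.atTop)
        (fun s => linkProduct_posSemidef J ((hprod x).ptMatrix₂_choi_posSemidef (hCP x) J)
          ((ih x).2 J) (boxSides s)) fun p q => ?_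
      have := ((ih x).1.tendsto_trunc (G x (ketbra (ket (J.piecewise q.1 p.1))
        (ket (J.piecewise p.1 q.1)))) (ket (J.piecewise q.2 p.2))
        (ket (J.piecewise p.2 q.2))).comp (tendsto_piFinset_boxSides (M x))
      refine this.congr fun S => ?_
      simp [trunc, ptMatrix₂, choi, entry]
    exact posSemidef_of_hasSum hcomp fun p q => hsum _ _ _

theorem IsLOCC.isPPT {n : ℕ} {I I' : Fin n → Type}
    {Λ : TC (∀ j, I j) →ₗ[ℂ] TC (∀ j, I' j)} (h : IsLOCC Λ) : IsPPT Λ := by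
  obtain ⟨hΛ, S, hS, hlim⟩ := h
  exact ⟨hΛ, fun J => posSemidef_of_tendsto (fun r => (hS r).isPPT.2 J) fun p q => hlim _ _ _⟩

/-! ### Averages of rank one projections -/

theorem norm_tensorVec {ι κ : Type} (u : Hilb ι) (w : Hilb κ) : ‖tensorVec u w‖ = ‖u‖ * ‖w‖ := by
  have h1 := hasSum_normSq (tensorVec u w)
  have h2 := (hasSum_normSq u).mul (hasSum_normSq w)
    ((hasSum_normSq u).summable.mul_of_nonneg (hasSum_normSq w).summable
      (fun _ => by positivity) (fun _ => by positivity))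
  have h3 : (fun p => ‖tensorVec u w p‖ ^ 2) = fun p : ι × κ => ‖u p.1‖ ^ 2 * ‖w p.2‖ ^ 2 := by
    ext p
    change ‖u p.1 * w p.2‖ ^ 2 = _
    rw [norm_mul, mul_pow]
  rw [h3] at h1
  have h4 := h1.unique h2
  rw [← mul_pow] at h4
  exact (pow_left_inj₀ (norm_nonneg _) (by positivity) two_ne_zero).1 h4

theorem continuous_tensorVec {ι κ : Type} :
    Continuous fun x : Hilb ι × Hilb κ => tensorVec x.1 x.2 := by
  have : IsBoundedBilinearMap ℂ fun x : Hilb ι × Hilb κ => tensorVec x.1 x.2 :=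
    { add_left := fun x y z => by ext p; exact add_mul _ _ _
      smul_left := fun c x y => by ext p; exact mul_assoc _ _ _
      add_right := fun x y z => by ext p; exact mul_add _ _ _
      smul_right := fun c x y => by ext p; exact mul_left_comm _ _ _
      bound := ⟨1, one_pos, fun x y => by rw [norm_tensorVec, one_mul]⟩ }
  exact this.continuous

theorem continuous_coord {ι : Type} (a : ι) : Continuous fun x : Hilb ι => x a := by
  have : (fun x : Hilb ι => x a) = fun x => ⟪ket a, x⟫_ℂ := funext fun x => (inner_ket a x).symm
  rw [this]
  fun_prop

theorem norm_coord_le {ι : Type} (x : Hilb ι) (a : ι) : ‖x a‖ ≤ ‖x‖ :=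
  lp.norm_apply_le_norm (by norm_num) x a

theorem sum_normSq_le {ι : Type} (x : Hilb ι) (s : Finset ι) :
    ∑ a ∈ s, ‖x a‖ ^ 2 ≤ ‖x‖ ^ 2 :=
  sum_le_hasSum s (fun _ _ => by positivity) (hasSum_normSq x)

section Average

variable {Ω : Type*} [MeasurableSpace Ω] {μ : Measure Ω} [IsProbabilityMeasure μ] {ι : Type}
  {v : Ω → Hilb ι}

theorem integrable_coord_mul (hv : AEStronglyMeasurable v μ) (h1 : ∀ α, ‖v α‖ = 1) (a b : ι) :
    Integrable (fun α => v α a * star (v α b)) μ := by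
  refine Integrable.of_bound (((continuous_coord a).comp_aestronglyMeasurable hv).mul
    (continuous_star.comp_aestronglyMeasurable
      ((continuous_coord b).comp_aestronglyMeasurable hv))) 1 (ae_of_all _ fun α => ?_)
  rw [norm_mul, norm_star]
  have ha := norm_coord_le (v α) a
  have hb := norm_coord_le (v α) b
  rw [h1] at ha hb
  exact mul_le_one₀ ha (norm_nonneg _) hb

theorem inner_integral_rankOne (hv : AEStronglyMeasurable v μ) (h1 : ∀ α, ‖v α‖ = 1)
    (x y : Hilb ι) : ⟪x, (∫ α, InnerProductSpace.rankOne ℂ (v α) (v α) ∂μ) y⟫_ℂ =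
      ∫ α, ⟪x, v α⟫_ℂ * ⟪v α, y⟫_ℂ ∂μ := by
  have hc : Continuous fun x : Hilb ι => InnerProductSpace.rankOne ℂ x x :=
    ((ContinuousLinearMap.smulRightL ℂ (Hilb ι) (Hilb ι)).continuous.comp
      (innerSL ℂ).continuous).clm_apply continuous_id
  have hfi : Integrable (fun α => InnerProductSpace.rankOne ℂ (v α) (v α)) μ := by
    refine Integrable.of_bound (hc.comp_aestronglyMeasurable hv) 1 (ae_of_all _ fun α => ?_)
    simp [h1]
  let L : Op ι →L[ℂ] ℂ := (innerSL ℂ x).comp (ContinuousLinearMap.apply ℂ (Hilb ι) y)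
  have hL : ∀ X, L X = ⟪x, X y⟫_ℂ := fun X => rfl
  rw [← hL, ← L.integral_comp_comm hfi]
  simp only [hL, InnerProductSpace.inner_right_rankOne_apply]

theorem entry_integral_rankOne (hv : AEStronglyMeasurable v μ) (h1 : ∀ α, ‖v α‖ = 1) (a b : ι) :
    entry (∫ α, InnerProductSpace.rankOne ℂ (v α) (v α) ∂μ) a b =
      ∫ α, v α a * star (v α b) ∂μ := by
  refine (inner_integral_rankOne hv h1 (ket a) (ket b)).trans (integral_congr_ae ?_)
  refine ae_of_all _ fun α => ?_
  simp only [inner_ket]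
  rw [← inner_conj_symm (v α), inner_ket]
  rfl

/-- Nonnegativity of the variance. -/
theorem sq_integral_le {f : Ω → ℝ} (hf : Integrable f μ) (hf2 : Integrable (fun α => f α ^ 2) μ) :
    (∫ α, f α ∂μ) ^ 2 ≤ ∫ α, f α ^ 2 ∂μ := by
  set m := ∫ α, f α ∂μ with hm
  have h0 : 0 ≤ ∫ α, (f α - m) ^ 2 ∂μ := integral_nonneg fun α => sq_nonneg _
  have h2 : ∫ α, (f α - m) ^ 2 ∂μ = ∫ α, f α ^ 2 ∂μ - m ^ 2 := by
    have : ∀ α, (f α - m) ^ 2 = f α ^ 2 - 2 * m * f α + m ^ 2 := fun α => by ring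
    simp only [this]
    have h3 : Integrable (fun α => f α ^ 2 - 2 * m * f α) μ := hf2.sub (hf.const_mul _)
    rw [integral_add h3 (integrable_const _),
      integral_sub hf2 (hf.const_mul _), integral_const_mul, ← hm]
    simp
    ring
  linarith

/-- By Jensen's inequality in each entry, the squared Hilbert–Schmidt norm of the average is at most
the average of those of the rank one projections, which is 1. Square summability is what partial
transposition, a permutation of the entries, preserves; it makes `ofMatrix` meaningful for R and
R_A. -/
theorem isHSMatrix_average (hv : AEStronglyMeasurable v μ) (h1 : ∀ α, ‖v α‖ = 1) :
    IsHSMatrix (Matrix.of fun a b => ∫ α, v α a * star (v α b) ∂μ) := by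
  classical
  have hfi := integrable_coord_mul hv h1
  have hbd : ∀ α (p : ι × ι), ‖v α p.1 * star (v α p.2)‖ ≤ 1 := fun α p => by
    rw [norm_mul, norm_star]
    have ha := norm_coord_le (v α) p.1
    have hb := norm_coord_le (v α) p.2
    rw [h1] at ha hb
    exact mul_le_one₀ ha (norm_nonneg _) hb
  have hfi2 : ∀ p : ι × ι, Integrable (fun α => ‖v α p.1 * star (v α p.2)‖ ^ 2) μ := fun p => by
    refine Integrable.of_bound ((hfi p.1 p.2).1.norm.pow 2) 1 (ae_of_all _ fun α => ?_)
    rw [norm_pow, norm_norm]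
    exact pow_le_one₀ (norm_nonneg _) (hbd α p)
  refine summable_of_sum_le (c := 1) (fun _ => by positivity) fun F => ?_
  calc ∑ p ∈ F, ‖∫ α, v α p.1 * star (v α p.2) ∂μ‖ ^ 2
      ≤ ∑ p ∈ F, ∫ α, ‖v α p.1 * star (v α p.2)‖ ^ 2 ∂μ := by
        refine Finset.sum_le_sum fun p _ => ?_
        exact (pow_le_pow_left₀ (norm_nonneg _) (norm_integral_le_integral_norm _) 2).trans
          (sq_integral_le (hfi p.1 p.2).norm (hfi2 p))
    _ = ∫ α, ∑ p ∈ F, ‖v α p.1 * star (v α p.2)‖ ^ 2 ∂μ :=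
        (integral_finsetSum _ fun p _ => hfi2 p).symm
    _ ≤ ∫ _, (1 : ℝ) ∂μ := by
        refine integral_mono (integrable_finsetSum _ fun p _ => hfi2 p) (integrable_const _)
          fun α => ?_
        have h2 := sum_normSq_le (tensorVec (v α) (star (v α))) F
        rw [norm_tensorVec, norm_star, h1] at h2
        simpa [tensorVec] using h2
    _ = 1 := by simp

theorem hasSum_average_diag [Countable ι] (hv : AEStronglyMeasurable v μ) (h1 : ∀ α, ‖v α‖ = 1) :
    HasSum (fun a => ∫ α, v α a * star (v α a) ∂μ) 1 := by
  have hsum : ∀ α, HasSum (fun a => ‖v α a‖ ^ 2) 1 := fun α => by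
    simpa [h1] using hasSum_normSq (v α)
  have := hasSum_integral_of_dominated_convergence (μ := μ)
    (F := fun a α => v α a * star (v α a)) (f := fun _ => (1 : ℂ)) (fun a α => ‖v α a‖ ^ 2)
    (fun a => (integrable_coord_mul hv h1 a a).1) (fun a => ae_of_all _ fun α => by simp [sq])
    (ae_of_all _ fun α => (hsum α).summable) (by simp [(hsum _).tsum_eq])
    (ae_of_all _ fun α => by
      have := Complex.hasSum_ofReal.2 (hsum α)
      simpa [Complex.mul_conj, Complex.normSq_eq_norm_sq] using this)
  simpa using this

end Average

/-! ### The matrices of R, of R_A and of their partial transposes -/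

section REntries

variable {Ω : Type*} [MeasurableSpace Ω] {ι κ : Type} (E : Ensemble Ω ι)
  (U : Hilb ι →ₗᵢ[ℂ] Hilb κ)

/-- The vector `ψ_α^* ⊗ U ψ_α`. -/
def Rvec (α : Ω) : Hilb (ι × κ) := tensorVec (star (E.ψ α)) (U (E.ψ α))

theorem norm_Rvec (α : Ω) : ‖Rvec E U α‖ = 1 := by
  rw [Rvec, norm_tensorVec, norm_star, U.norm_map, E.norm_one, one_mul]

theorem Rvec_apply (α : Ω) (p : ι × κ) :
    Rvec E U α p = star (E.ψ α p.1) * U (E.ψ α) p.2 := rfl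

theorem aestronglyMeasurable_Rvec : AEStronglyMeasurable (Rvec E U) E.μ :=
  continuous_tensorVec.comp_aestronglyMeasurable
    ((continuous_star.comp_aestronglyMeasurable E.meas).prodMk
      (U.continuous.comp_aestronglyMeasurable E.meas))

theorem entry_Rop (p q : ι × κ) :
    entry (Rop E U) p q = ∫ α, Rvec E U α p * star (Rvec E U α q) ∂E.μ :=
  have := E.isProb
  entry_integral_rankOne (aestronglyMeasurable_Rvec E U) (norm_Rvec E U) p q

theorem isHSMatrix_Rop : IsHSMatrix (entry (Rop E U)) := by
  have := E.isProb
  have := isHSMatrix_average (aestronglyMeasurable_Rvec E U) (norm_Rvec E U)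
  convert this using 1
  ext p q
  exact entry_Rop E U p q

end REntries

theorem isHSMatrix_ptMatrix₂ {n : ℕ} {I I' : Fin n → Type} (J : Finset (Fin n))
    {M : Matrix ((∀ j, I j) × (∀ j, I' j)) ((∀ j, I j) × (∀ j, I' j)) ℂ} (hM : IsHSMatrix M) :
    IsHSMatrix (ptMatrix₂ J M) := by
  let e : ((∀ j, I j) × (∀ j, I' j)) × ((∀ j, I j) × (∀ j, I' j)) →
      ((∀ j, I j) × (∀ j, I' j)) × ((∀ j, I j) × (∀ j, I' j)) := fun x =>
    ((J.piecewise x.2.1 x.1.1, J.piecewise x.2.2 x.1.2),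
      (J.piecewise x.1.1 x.2.1, J.piecewise x.1.2 x.2.2))
  have he : Function.Involutive e := fun x => by
    simp only [e, piecewise_piecewise_swap]
  have h := Summable.comp_injective hM he.injective
  simpa only [IsHSMatrix, ptMatrix₂, Matrix.of_apply, Function.comp_def] using h

theorem isHSMatrix_ptMatrix {n : ℕ} {I : Fin n → Type} (J : Finset (Fin n))
    {M : Matrix (∀ j, I j) (∀ j, I j) ℂ} (hM : IsHSMatrix M) : IsHSMatrix (ptMatrix J M) := by
  let e : (∀ j, I j) × (∀ j, I j) → (∀ j, I j) × (∀ j, I j) := fun x =>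
    (J.piecewise x.2 x.1, J.piecewise x.1 x.2)
  have he : Function.Involutive e := fun x => by
    simp only [e, piecewise_piecewise_swap]
  have h := Summable.comp_injective hM he.injective
  simpa only [IsHSMatrix, ptMatrix, Matrix.of_apply, Function.comp_def] using h

theorem entry_partialTranspose₂_Rop {Ω : Type*} [MeasurableSpace Ω] {n : ℕ} {I I' : Fin n → Type}
    (E : Ensemble Ω (∀ j, I j)) (U : Hilb (∀ j, I j) →ₗᵢ[ℂ] Hilb (∀ j, I' j))
    (J : Finset (Fin n)) :
    entry (partialTranspose₂ J (Rop E U)) = ptMatrix₂ J (entry (Rop E U)) :=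
  entry_ofMatrix (isHSMatrix_ptMatrix₂ J (isHSMatrix_Rop E U))

/-- The matrix of `R_A`. -/
theorem entry_partialTrace_Rop {Ω : Type*} [MeasurableSpace Ω] {ι κ : Type} [Countable κ]
    (E : Ensemble Ω ι) (U : Hilb ι →ₗᵢ[ℂ] Hilb κ) :
    IsHSMatrix (entry (partialTrace (Rop E U))) ∧
    entry (partialTrace (Rop E U)) =
      Matrix.of fun a b => ∫ α, star (E.ψ α a) * E.ψ α b ∂E.μ := by
  have := E.isProb
  have hstar : AEStronglyMeasurable (fun α => star (E.ψ α)) E.μ :=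
    continuous_star.comp_aestronglyMeasurable E.meas
  have hM := isHSMatrix_average hstar fun α => by rw [norm_star, E.norm_one]
  simp only [lp.star_apply, star_star] at hM
  have e : (Matrix.of fun a b => ∑' c, entry (Rop E U) (a, c) (b, c)) =
      Matrix.of fun a b => ∫ α, star (E.ψ α a) * E.ψ α b ∂E.μ := by
    ext a b
    refine HasSum.tsum_eq ?_
    simp only [entry_Rop]
    have hsum : ∀ α, HasSum (fun c => ‖U (E.ψ α) c‖ ^ 2) 1 := fun α => by
      simpa [U.norm_map, E.norm_one] using hasSum_normSq (U (E.ψ α))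
    -- The dominating terms |(Uψ)_c|² sum to 1 over c; the factors from A have modulus at most 1.
    refine hasSum_integral_of_dominated_convergence (fun c α => ‖U (E.ψ α) c‖ ^ 2)
      (fun c => (integrable_coord_mul (aestronglyMeasurable_Rvec E U) (norm_Rvec E U) _ _).1)
      (fun c => ae_of_all _ fun α => ?_) (ae_of_all _ fun α => (hsum α).summable)
      (by simp [(hsum _).tsum_eq]) (ae_of_all _ fun α => ?_)
    · have ha := norm_coord_le (E.ψ α) a
      have hb := norm_coord_le (E.ψ α) b
      rw [E.norm_one] at ha hb
      simp only [Rvec_apply, norm_mul, norm_star]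
      calc _ = (‖E.ψ α a‖ * ‖E.ψ α b‖) * ‖U (E.ψ α) c‖ ^ 2 := by ring
        _ ≤ 1 * ‖U (E.ψ α) c‖ ^ 2 := by
          gcongr
          exact mul_le_one₀ ha (norm_nonneg _) hb
        _ = _ := one_mul _
    · have := (Complex.hasSum_ofReal.2 (hsum α)).mul_left (star (E.ψ α a) * E.ψ α b)
      simp only [Complex.ofReal_one, mul_one] at this
      have e : (fun c => Rvec E U α (a, c) * star (Rvec E U α (b, c))) = fun c =>
          star (E.ψ α a) * E.ψ α b * ((‖U (E.ψ α) c‖ ^ 2 : ℝ) : ℂ) := funext fun c => ?_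
      · rw [e]
        exact this
      rw [Rvec_apply, Rvec_apply, ← Complex.normSq_eq_norm_sq, ← Complex.mul_conj, star_mul,
        star_star, starRingEnd_apply]
      ring
  have h2 : entry (partialTrace (Rop E U)) = _ := entry_ofMatrix (e ▸ hM)
  rw [h2, e]
  exact ⟨hM, rfl⟩

/-! ### The min-entropy bound -/

theorem tr_comp_rankOne {ι : Type} (X : Op ι) (u w : Hilb ι) :
    tr (X ∘L InnerProductSpace.rankOne ℂ u w) = ⟪w, X u⟫_ℂ := by
  refine HasSum.tsum_eq ?_
  have h := lp.hasSum_inner (𝕜 := ℂ) w (X u)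
  have e : (fun a => entry (X ∘L InnerProductSpace.rankOne ℂ u w) a a) =
      fun a => ⟪w a, X u a⟫_ℂ := by
    ext a
    rw [entry_apply, ContinuousLinearMap.comp_apply, InnerProductSpace.rankOne_apply, map_smul,
      lp.coeFn_smul, Pi.smul_apply, ← inner_conj_symm, inner_ket, smul_eq_mul, RCLike.inner_apply,
      mul_comm]
  rw [e]
  exact h

theorem tr_ketbra_ket {ι : Type} [DecidableEq ι] (a b : ι) :
    tr (ketbra (ket a) (ket b) : Op ι) = if a = b then 1 else 0 := by
  have h := tr_comp_rankOne (1 : Op ι) (ket a) (ket b)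
  have e : (1 : Op ι) ∘L InnerProductSpace.rankOne ℂ (ket a) (ket b) =
      (ketbra (ket a) (ket b) : Op ι) := rfl
  rw [e] at h
  rw [h, one_apply_eq_self, ket_inner_ket]
  simp only [eq_comm]

/-- Fatou's lemma. Only an upper bound is wanted, so no domination is needed; the filter of finite
subsets is countably generated because the bases are countable. -/
theorem lintegral_ofReal_le_of_tendsto {Ω β : Type*} [MeasurableSpace Ω] {μ : Measure Ω}
    {l : Filter β} [l.NeBot] [l.IsCountablyGenerated] {f : β → Ω → ℝ} {g : Ω → ℝ}
    {c : β → ℝ≥0∞} {c₀ : ℝ≥0∞} (hf : ∀ x, AEMeasurable (f x) μ)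
    (hfg : ∀ α, Filter.Tendsto (fun x => f x α) l (𝓝 (g α)))
    (hc : ∀ x, ∫⁻ α, ENNReal.ofReal (f x α) ∂μ ≤ c x) (hc₀ : Filter.Tendsto c l (𝓝 c₀)) :
    ∫⁻ α, ENNReal.ofReal (g α) ∂μ ≤ c₀ :=
  calc ∫⁻ α, ENNReal.ofReal (g α) ∂μ
      = ∫⁻ α, Filter.liminf (fun x => ENNReal.ofReal (f x α)) l ∂μ :=
        lintegral_congr fun α => ((ENNReal.continuous_ofReal.tendsto _).comp (hfg α)).liminf_eq.symm
    _ ≤ Filter.liminf (fun x => ∫⁻ α, ENNReal.ofReal (f x α) ∂μ) l :=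
        lintegral_liminf_le' fun x => (hf x).ennreal_ofReal
    _ ≤ Filter.liminf c l := Filter.liminf_le_liminf (Filter.Eventually.of_forall hc)
    _ = c₀ := hc₀.liminf_eq

/-- `Tr[A^Γ B^Γ] = Tr[A B]` on a finite box. -/
theorem sum_ptMatrix₂_mul_ptMatrix₂ {n : ℕ} {I I' : Fin n → Type} (J : Finset (Fin n))
    (A B : Matrix ((∀ j, I j) × (∀ j, I' j)) ((∀ j, I j) × (∀ j, I' j)) ℂ)
    (S : ∀ j, Finset (I j)) (T : ∀ j, Finset (I' j)) :
    ∑ p ∈ Fintype.piFinset S ×ˢ Fintype.piFinset T, ∑ q ∈ Fintype.piFinset S ×ˢ Fintype.piFinset T,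
        ptMatrix₂ J A p q * ptMatrix₂ J B q p =
      ∑ p ∈ Fintype.piFinset S ×ˢ Fintype.piFinset T,
        ∑ q ∈ Fintype.piFinset S ×ˢ Fintype.piFinset T, A p q * B q p := by
  have hcomm : ∀ F : (∀ j, I j) × (∀ j, I' j) → (∀ j, I j) × (∀ j, I' j) → ℂ,
      ∑ p ∈ Fintype.piFinset S ×ˢ Fintype.piFinset T,
        ∑ q ∈ Fintype.piFinset S ×ˢ Fintype.piFinset T, F p q =
      ∑ a ∈ Fintype.piFinset S, ∑ b ∈ Fintype.piFinset S, ∑ c ∈ Fintype.piFinset T,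
        ∑ d ∈ Fintype.piFinset T, F (a, c) (b, d) := fun F => by
    rw [Finset.sum_product]
    refine Finset.sum_congr rfl fun a _ => ?_
    simp only [Finset.sum_product]
    rw [Finset.sum_comm]
  rw [hcomm, hcomm]
  refine Eq.trans ?_ (sum_piFinset_piecewise J S _)
  refine Finset.sum_congr rfl fun a _ => Finset.sum_congr rfl fun b _ => ?_
  refine Eq.trans ?_ (sum_piFinset_piecewise J T _)
  rfl

/-- Diagonal output labels are unaffected by the swap, so the sum is the trace of Λ on a matrix unit
with swapped labels. These two labels coincide exactly when a = b. -/
theorem IsTP.hasSum_ptMatrix₂_choi {n : ℕ} {I I' : Fin n → Type} [DecidableEq (∀ j, I j)]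
    {Λ : TC (∀ j, I j) →ₗ[ℂ] TC (∀ j, I' j)} (hΛ : IsTP Λ) (J : Finset (Fin n))
    (a b : ∀ j, I j) :
    HasSum (fun c => ptMatrix₂ J (choi Λ) (b, c) (a, c)) (if a = b then 1 else 0) := by
  have h := (summable_entry_diag
    (Λ (ketbra (ket (J.piecewise a b)) (ket (J.piecewise b a))))).hasSum
  have h2 := hΛ (ketbra (ket (J.piecewise a b)) (ket (J.piecewise b a)))
  rw [tr_ketbra_ket] at h2
  have h3 : J.piecewise a b = J.piecewise b a ↔ a = b := by
    refine ⟨fun h => ?_, fun h => by rw [h]⟩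
    ext j
    have := congrFun h j
    by_cases hj : j ∈ J <;> simp [hj] at this <;> simp [this]
  simp only [h3] at h2
  rw [← h2]
  simp only [ptMatrix₂, choi, Matrix.of_apply, piecewise_self]
  exact h

/-- The truncated form of the fidelity as Tr[R C] for one state. With q = (a, c) and p = (b, d), the
coefficient x_a x̄_b of the matrix unit |a⟩⟨b| appears at the entry (p, q) as that of the conjugated
vector. -/
theorem inner_trunc_eq {ι κ : Type} (Λ : TC ι →ₗ[ℂ] TC κ) (x : Hilb ι) (u : Hilb κ)
    (s : Finset ι) (t : Finset κ) :
    ⟪∑ c ∈ t, u c • (ket c : Hilb κ), (Λ (trunc s (InnerProductSpace.rankOne ℂ x x)) : Op κ)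
      (∑ c ∈ t, u c • ket c)⟫_ℂ = ∑ p ∈ s ×ˢ t, ∑ q ∈ s ×ˢ t,
        tensorVec (star x) u p * star (tensorVec (star x) u q) * choi Λ q p := by
  have hentry : ∀ c d, entry (Λ (trunc s (InnerProductSpace.rankOne ℂ x x)) : Op κ) c d =
      ∑ a ∈ s, ∑ b ∈ s, x a * star (x b) * choi Λ (a, c) (b, d) := fun c d => by
    simp [trunc, entry_sum, entry_smul, Matrix.sum_apply, entry_rankOne, choi]
  rw [inner_sum_ket]
  simp only [hentry, Finset.sum_product, Finset.mul_sum, Finset.sum_mul]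
  have hcomm : ∀ F : ι → κ → ι → κ → ℂ, ∑ b ∈ s, ∑ d ∈ t, ∑ a ∈ s, ∑ c ∈ t, F b d a c =
      ∑ c ∈ t, ∑ d ∈ t, ∑ a ∈ s, ∑ b ∈ s, F b d a c := fun F => by
    simp only [← Finset.sum_product']
    refine Finset.sum_nbij' (fun x => (x.2.2.2, x.2.1, x.2.2.1, x.1))
      (fun x => (x.2.2.2, x.2.1, x.2.2.1, x.1)) ?_ ?_ ?_ ?_ ?_ <;> simp +contextual
  rw [hcomm]
  refine Finset.sum_congr rfl fun c _ => Finset.sum_congr rfl fun d _ =>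
    Finset.sum_congr rfl fun a _ => Finset.sum_congr rfl fun b _ => ?_
  simp only [tensorVec, lp.star_apply, star_mul, star_star]
  ring

/-! ### The bound for a single channel -/

section MainBound

variable {Ω : Type*} [MeasurableSpace Ω] {n : ℕ} {I I' : Fin n → Type}
  (E : Ensemble Ω (∀ j, I j)) (U : Hilb (∀ j, I j) →ₗᵢ[ℂ] Hilb (∀ j, I' j))

theorem lintegral_truncated_eq {Λ : TC (∀ j, I j) →ₗ[ℂ] TC (∀ j, I' j)} (hΛ : IsCP Λ)
    (s : Finset (∀ j, I j)) (t : Finset (∀ j, I' j)) :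
    ∫⁻ α, ENNReal.ofReal (∑ p ∈ s ×ˢ t, ∑ q ∈ s ×ˢ t,
      Rvec E U α p * star (Rvec E U α q) * choi Λ q p).re ∂E.μ =
    ENNReal.ofReal (∑ p ∈ s ×ˢ t, ∑ q ∈ s ×ˢ t, entry (Rop E U) p q * choi Λ q p).re := by
  have := E.isProb
  have hfi : ∀ p q, Integrable
      (fun α => Rvec E U α p * star (Rvec E U α q) * choi Λ q p) E.μ := fun p q =>
    (integrable_coord_mul (aestronglyMeasurable_Rvec E U) (norm_Rvec E U) p q).mul_const _
  have hfi2 : Integrable (fun α => ∑ p ∈ s ×ˢ t, ∑ q ∈ s ×ˢ t,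
      Rvec E U α p * star (Rvec E U α q) * choi Λ q p) E.μ :=
    integrable_finsetSum _ fun p _ => integrable_finsetSum _ fun q _ => hfi p q
  refine (ofReal_integral_eq_lintegral_ofReal hfi2.re (ae_of_all _ fun α => ?_)).symm.trans ?_
  rotate_left
  · congr 1
    have h := integral_re hfi2
    refine h.trans ?_
    rw [integral_finsetSum _ fun p _ => integrable_finsetSum _ fun q _ => hfi p q]
    change (Complex.re _) = Complex.re _
    congr 1
    refine Finset.sum_congr rfl fun p _ => ?_
    rw [integral_finsetSum _ fun q _ => hfi p q]
    refine Finset.sum_congr rfl fun q _ => ?_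
    rw [integral_mul_const, entry_Rop]
  -- Passing from the lower integral to the Bochner integral requires a nonnegative integrand, which
  -- complete positivity provides even after truncation.
  · have h := inner_trunc_eq Λ (E.ψ α) (U (E.ψ α)) s t
    change 0 ≤ Complex.re _
    simp only [Rvec]
    rw [← h]
    exact (Complex.nonneg_iff.1 ((hΛ.isPositive _ (trunc_isPositive s
      (InnerProductSpace.isPositive_rankOne_self _))).inner_nonneg_right _)).1

/-- The heart of the bound: pair the positive matrices κ ξ ⊗ 1 − R^Γ and C^Γ on a box, then undo
both transpositions in the term with R. -/
theorem sum_Rop_mul_choi_le {Λ : TC (∀ j, I j) →ₗ[ℂ] TC (∀ j, I' j)} {J : Finset (Fin n)}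
    (hJ : (ptMatrix₂ J (choi Λ)).PosSemidef) {κ : ℝ} {ξ : Op (∀ j, I j)}
    (hle : partialTranspose₂ J (Rop E U) ≤ (κ : ℂ) • tensorOne (∀ j, I' j) ξ)
    (S : ∀ j, Finset (I j)) (T : ∀ j, Finset (I' j)) :
    (∑ p ∈ Fintype.piFinset S ×ˢ Fintype.piFinset T,
      ∑ q ∈ Fintype.piFinset S ×ˢ Fintype.piFinset T, entry (Rop E U) p q * choi Λ q p).re ≤
    (κ * ∑ a ∈ Fintype.piFinset S, ∑ b ∈ Fintype.piFinset S, entry ξ a b *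
      ∑ c ∈ Fintype.piFinset T, ptMatrix₂ J (choi Λ) (b, c) (a, c)).re := by
  classical
  rw [le_iff_entry, entry_partialTranspose₂_Rop, entry_smul] at hle
  have h := (Complex.nonneg_iff.1
    (hle.sum_mul_nonneg hJ (Fintype.piFinset S ×ˢ Fintype.piFinset T))).1
  simp only [Matrix.sub_apply, sub_mul, Finset.sum_sub_distrib] at h
  rw [sum_ptMatrix₂_mul_ptMatrix₂, Complex.sub_re, sub_nonneg] at h
  refine h.trans_eq (congrArg Complex.re ?_)
  simp only [Finset.sum_product, Matrix.smul_apply, entry_tensorOne, Finset.mul_sum]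
  refine Finset.sum_congr rfl fun a _ => ?_
  rw [Finset.sum_comm]
  refine Finset.sum_congr rfl fun b _ => ?_
  refine Finset.sum_congr rfl fun c hc => ?_
  rw [Finset.sum_eq_single_of_mem c hc fun d _ hd => by simp [Ne.symm hd]]
  simp [mul_assoc]

theorem avgFidelity_le [∀ j, Countable (I j)] [∀ j, Countable (I' j)]
    {Λ : TC (∀ j, I j) →ₗ[ℂ] TC (∀ j, I' j)} (hΛ : IsChannel Λ) {J : Finset (Fin n)}
    (hJ : (ptMatrix₂ J (choi Λ)).PosSemidef) {κ : ℝ} (hκ : 0 ≤ κ) {ξ : Op (∀ j, I j)}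
    (hξ : IsState ξ)
    (hle : partialTranspose₂ J (Rop E U) ≤ (κ : ℂ) • tensorOne (∀ j, I' j) ξ) :
    avgFidelity E U Λ ≤ ENNReal.ofReal κ := by
  classical
  have hR := aestronglyMeasurable_Rvec E U
  -- The input box is kept fixed while the output box grows. Then only finitely many input labels
  -- occur, the partial trace of C^Γ converges to the identity on them, and what remains is κ times
  -- a partial sum of Tr ξ. The input box grows afterwards.
  have hstep : ∀ s₀ : Finset (∀ j, I j), ∫⁻ α, ENNReal.ofReal (⟪U (E.ψ α),
      (Λ (trunc (Fintype.piFinset (boxSides s₀)) (InnerProductSpace.rankOne ℂ (E.ψ α) (E.ψ α))) :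
        Op (∀ j, I' j)) (U (E.ψ α))⟫_ℂ).re ∂E.μ ≤ ENNReal.ofReal κ := by
    intro s₀
    set s := Fintype.piFinset (boxSides s₀) with hs
    let t : Finset (∀ j, I' j) → Finset (∀ j, I' j) := fun t₀ => Fintype.piFinset (boxSides t₀)
    have ht : Filter.Tendsto t Filter.atTop Filter.atTop := tendsto_piFinset_boxSides I'
    have hlim : Filter.Tendsto (fun t₀ => ENNReal.ofReal (κ * ∑ a ∈ s, ∑ b ∈ s, entry ξ a b *
        ∑ c ∈ t t₀, ptMatrix₂ J (choi Λ) (b, c) (a, c)).re) Filter.atTop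
        (𝓝 (ENNReal.ofReal (κ * ∑ a ∈ s, ∑ b ∈ s, entry ξ a b * if a = b then 1 else 0).re)) := by
      refine (ENNReal.continuous_ofReal.tendsto _).comp ((Complex.continuous_re.tendsto _).comp
        (Filter.Tendsto.const_mul _ (tendsto_finsetSum _ fun a _ => tendsto_finsetSum _ fun b _ =>
          Filter.Tendsto.const_mul _ ?_)))
      have h : Filter.Tendsto (fun t => ∑ c ∈ t, ptMatrix₂ J (choi Λ) (b, c) (a, c)) Filter.atTop
        (𝓝 (if a = b then 1 else 0)) := hΛ.2.hasSum_ptMatrix₂_choi J a b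
      exact h.comp ht
    have hbound : ENNReal.ofReal (κ * ∑ a ∈ s, ∑ b ∈ s, entry ξ a b * if a = b then 1 else 0).re ≤
        ENNReal.ofReal κ := by
      refine ENNReal.ofReal_le_ofReal ?_
      have h1 : ∑ a ∈ s, ∑ b ∈ s, entry ξ a b * (if a = b then (1 : ℂ) else 0) =
          ∑ a ∈ s, entry ξ a a := Finset.sum_congr rfl fun a ha => by simp [ha]
      rw [h1, Complex.re_ofReal_mul, Complex.re_sum]
      have h2 := sum_le_hasSum s (fun a _ => (Complex.nonneg_iff.1
        (posSemidef_entry_iff.2 hξ.1).diag_nonneg).1) (Complex.hasSum_re hξ.2)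
      exact mul_le_of_le_one_right hκ h2
    refine le_trans (lintegral_ofReal_le_of_tendsto (l := Filter.atTop)
      (f := fun t₀ α => (∑ p ∈ s ×ˢ t t₀, ∑ q ∈ s ×ˢ t t₀,
        Rvec E U α p * star (Rvec E U α q) * choi Λ q p).re) (fun t₀ => ?_) (fun α => ?_)
        (fun t₀ => ?_) hlim) hbound
    · refine (Complex.continuous_re.comp_aestronglyMeasurable ?_).aemeasurable
      refine Finset.aestronglyMeasurable_fun_sum _ fun p _ =>
        Finset.aestronglyMeasurable_fun_sum _ fun q _ => ?_
      exact (((continuous_coord p).comp_aestronglyMeasurable hR).mul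
        (continuous_star.comp_aestronglyMeasurable
          ((continuous_coord q).comp_aestronglyMeasurable hR))).mul_const _
    · refine (Complex.continuous_re.tendsto _).comp ?_
      simp only [Rvec, ← inner_trunc_eq]
      have hk : Filter.Tendsto (fun t => ∑ c ∈ t, U (E.ψ α) c • (ket c : Hilb (∀ j, I' j)))
        Filter.atTop (𝓝 (U (E.ψ α))) := hasSum_ket _
      have hu := hk.comp ht
      exact hu.inner (((ContinuousLinearMap.continuous _).tendsto _).comp hu)
    · rw [lintegral_truncated_eq E U hΛ.1]
      exact ENNReal.ofReal_le_ofReal (sum_Rop_mul_choi_le E U hJ hle _ _)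
  have hav : avgFidelity E U Λ = ∫⁻ α, ENNReal.ofReal (⟪U (E.ψ α),
      (Λ (ketbra (E.ψ α) (E.ψ α)) : Op (∀ j, I' j)) (U (E.ψ α))⟫_ℂ).re ∂E.μ :=
    lintegral_congr fun α => by rw [← tr_comp_rankOne]; rfl
  rw [hav]
  refine lintegral_ofReal_le_of_tendsto (l := Filter.atTop) (fun s₀ => ?_) (fun α => ?_) hstep
    tendsto_const_nhds
  · have hc : Continuous fun x : Hilb (∀ j, I j) => (⟪U x,
        (Λ (trunc (Fintype.piFinset (boxSides s₀)) (InnerProductSpace.rankOne ℂ x x)) :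
          Op (∀ j, I' j)) (U x)⟫_ℂ).re := by
      simp only [trunc, LinearMap.coe_mk, AddHom.coe_mk, map_sum, map_smul, entry_rankOne,
        Submodule.coe_sum, Submodule.coe_smul, sum_apply, smul_apply, inner_sum, inner_smul_right]
      refine Complex.continuous_re.comp (continuous_finsetSum _ fun a _ =>
        continuous_finsetSum _ fun b _ => ?_)
      exact ((continuous_coord a).mul (continuous_coord b).star).mul (by fun_prop)
    exact (hc.comp_aestronglyMeasurable E.meas).aemeasurable
  · exact (Complex.continuous_re.tendsto _).comp ((hΛ.tendsto_trunc (ketbra (E.ψ α) (E.ψ α))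
      (U (E.ψ α)) (U (E.ψ α))).comp (tendsto_piFinset_boxSides I))

end MainBound

/-! ### Reformulations and symmetries of the bounds -/

theorem smul_le_smul_of_isPositive {ι : Type} {Y : Op ι} (hY : Y.IsPositive) {k l : ℝ}
    (h : k ≤ l) : (k : ℂ) • Y ≤ (l : ℂ) • Y := by
  rw [ContinuousLinearMap.le_def, ← sub_smul]
  refine hY.smul_of_nonneg ?_
  rw [← Complex.ofReal_sub]
  exact_mod_cast sub_nonneg.2 h

theorem iInf_dmax_eq {ι κ : Type} (X : Op (ι × κ)) :
    (⨅ (ξ : Op ι) (_ : IsState ξ), dmax X (tensorOne κ ξ)) =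
      ⨅ (k : ℝ) (_ : 0 ≤ k ∧ ∃ ξ : Op ι, IsState ξ ∧ X ≤ (k : ℂ) • tensorOne κ ξ),
        ENNReal.ofReal k := by
  refine le_antisymm (le_iInf₂ fun k hk => ?_) (le_iInf₂ fun ξ hξ => le_iInf₂ fun l hl =>
    iInf₂_le_of_le l ⟨hl.1.le, ξ, hξ, hl.2⟩ le_rfl)
  obtain ⟨hk, ξ, hξ, hle⟩ := hk
  -- The value k = 0 is excluded in `dmax`, so k is enlarged by ε; positivity of ξ ⊗ 1 keeps the
  -- inequality.
  refine iInf₂_le_of_le ξ hξ (ENNReal.le_of_forall_pos_le_add fun ε hε _ => ?_)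
  have hε' : (0 : ℝ) < ε := by exact_mod_cast hε
  refine iInf₂_le_of_le (k + ε) ⟨by positivity, hle.trans ?_⟩ ?_
  · exact smul_le_smul_of_isPositive (tensorOne_isPositive hξ.1) (by linarith)
  · rw [ENNReal.ofReal_add hk hε'.le, ENNReal.ofReal_coe_nnreal]

theorem dmax_eq_of_transpose {ι : Type} {X X' Y Y' : Op ι} (hX : entry X' = (entry X).transpose)
    (hY : entry Y' = (entry Y).transpose) : dmax X' Y' = dmax X Y := by
  have h : ∀ l : ℝ, X' ≤ (l : ℂ) • Y' ↔ X ≤ (l : ℂ) • Y := fun l => by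
    rw [le_iff_entry, le_iff_entry, entry_smul, entry_smul, hX, hY, ← Matrix.transpose_smul,
      ← Matrix.transpose_sub, Matrix.posSemidef_transpose_iff]
  simp only [dmax, h]

theorem entry_tensorOne_transpose {ι κ : Type} {Y Y' : Op ι}
    (hY : entry Y' = (entry Y).transpose) :
    entry (tensorOne κ Y') = (entry (tensorOne κ Y)).transpose := by
  classical
  ext ⟨a, c⟩ ⟨b, d⟩
  rw [Matrix.transpose_apply, entry_tensorOne, entry_tensorOne, hY]
  simp only [Matrix.transpose_apply, eq_comm]

theorem piecewise_compl_swap {n : ℕ} {I : Fin n → Type} (J : Finset (Fin n)) (a b : ∀ j, I j) :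
    Jᶜ.piecewise a b = J.piecewise b a := by
  ext j
  by_cases hj : j ∈ J <;> simp [hj]

/-- Swapping the coordinates outside J is the same as swapping all of them and then those in J once
more. -/
theorem ptMatrix₂_compl {n : ℕ} {I I' : Fin n → Type} (J : Finset (Fin n))
    (M : Matrix ((∀ j, I j) × (∀ j, I' j)) ((∀ j, I j) × (∀ j, I' j)) ℂ) :
    ptMatrix₂ Jᶜ M = (ptMatrix₂ J M).transpose := by
  ext p q
  simp only [ptMatrix₂, Matrix.of_apply, Matrix.transpose_apply, piecewise_compl_swap]

theorem ptMatrix_compl {n : ℕ} {I : Fin n → Type} (J : Finset (Fin n))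
    (M : Matrix (∀ j, I j) (∀ j, I j) ℂ) : ptMatrix Jᶜ M = (ptMatrix J M).transpose := by
  ext p q
  simp only [ptMatrix, Matrix.of_apply, Matrix.transpose_apply, piecewise_compl_swap]

/-! ### Vectors of the form `∑ a, |a⟩ ⊗ U|a⟩` -/

theorem hasSum_star_mul {ι : Type} (x y : Hilb ι) :
    HasSum (fun a => star (x a) * y a) ⟪x, y⟫_ℂ := by
  have h := lp.hasSum_inner (𝕜 := ℂ) x y
  have e : (fun a => star (x a) * y a) = fun a => ⟪x a, y a⟫_ℂ := funext fun a => by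
    rw [RCLike.inner_apply, mul_comm]
    rfl
  rw [e]
  exact h

theorem inner_tensorVec {ι κ : Type} (u u' : Hilb ι) (w w' : Hilb κ) :
    ⟪tensorVec u w, tensorVec u' w'⟫_ℂ = ⟪u, u'⟫_ℂ * ⟪w, w'⟫_ℂ := by
  have h := hasSum_star_mul (tensorVec u w) (tensorVec u' w')
  have e : (fun p => star (tensorVec u w p) * tensorVec u' w' p) =
      fun p : ι × κ => (star (u p.1) * u' p.1) * (star (w p.2) * w' p.2) := by
    ext p
    change star (u p.1 * w p.2) * (u' p.1 * w' p.2) = _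
    rw [star_mul]
    ring
  rw [e] at h
  have h2 := HasSum.mul (hasSum_star_mul u u') (hasSum_star_mul w w') h.summable
  exact h.unique h2

theorem tensorOne_tensorVec {ι κ : Type} (X : Op ι) (u : Hilb ι) (w : Hilb κ) :
    tensorOne κ X (tensorVec u w) = tensorVec (X u) w := by
  ext ⟨a, c⟩
  change ⟪ket a, X (slice c (tensorVec u w))⟫_ℂ = X u a * w c
  have h : slice c (tensorVec u w) = w c • u := by
    ext b
    exact mul_comm _ _
  rw [h, map_smul, inner_smul_right, inner_ket, mul_comm]

/-- The simulating isometry attains fidelity one, which forces `κ ≥ 1` if nothing is transposed. -/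
theorem one_le_of_Rop_le {Ω : Type*} [MeasurableSpace Ω] {ι κ : Type} [Countable ι]
    (E : Ensemble Ω ι) (U : Hilb ι →ₗᵢ[ℂ] Hilb κ) {k : ℝ} (hk : 0 ≤ k) {ξ : Op ι}
    (hξ : IsState ξ) (hle : Rop E U ≤ (k : ℂ) • tensorOne κ ξ) : 1 ≤ k := by
  classical
  have := E.isProb
  -- A truncation of the unnormalised Choi vector of U. It overlaps with ψ* ⊗ Uψ in ∑ |ψ_a|², which
  -- tends to 1, whereas ξ ⊗ 1 has on it the expectation ∑ ξ_aa ≤ 1.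
  let w : Finset ι → Hilb (ι × κ) := fun s => ∑ a ∈ s, tensorVec (ket a) (U (ket a))
  have hsum : ∀ α, HasSum (fun a => ‖E.ψ α a‖ ^ 2) 1 := fun α => by
    simpa [E.norm_one] using hasSum_normSq (E.ψ α)
  have hov : ∀ s α, ⟪w s, Rvec E U α⟫_ℂ = ((∑ a ∈ s, ‖E.ψ α a‖ ^ 2 : ℝ) : ℂ) := fun s α => by
    simp only [w, sum_inner, Rvec, inner_tensorVec, U.inner_map_map, inner_ket, lp.star_apply]
    rw [Complex.ofReal_sum]
    refine Finset.sum_congr rfl fun a _ => ?_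
    rw [← Complex.normSq_eq_norm_sq, ← Complex.mul_conj, mul_comm]
    rfl
  have hR : ∀ s, ⟪w s, Rop E U (w s)⟫_ℂ =
      ((∫ α, (∑ a ∈ s, ‖E.ψ α a‖ ^ 2) ^ 2 ∂E.μ : ℝ) : ℂ) := fun s => by
    refine (inner_integral_rankOne (aestronglyMeasurable_Rvec E U) (norm_Rvec E U) _ _).trans ?_
    rw [← integral_complex_ofReal]
    refine integral_congr_ae (ae_of_all _ fun α => ?_)
    change ⟪w s, Rvec E U α⟫_ℂ * ⟪Rvec E U α, w s⟫_ℂ = _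
    rw [← inner_conj_symm (Rvec E U α), hov, Complex.conj_ofReal, ← Complex.ofReal_mul, ← sq]
  have hX : ∀ s, ⟪w s, tensorOne κ ξ (w s)⟫_ℂ = ∑ a ∈ s, entry ξ a a := fun s => by
    simp only [w, map_sum, sum_inner, inner_sum, tensorOne_tensorVec, inner_tensorVec,
      U.inner_map_map, ket_inner_ket]
    rw [Finset.sum_comm]
    exact Finset.sum_congr rfl fun a ha => by simp [ha, entry]
  have hbound : ∀ s : Finset ι, ∫ α, (∑ a ∈ s, ‖E.ψ α a‖ ^ 2) ^ 2 ∂E.μ ≤ k := fun s => by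
    have h1 := (Complex.nonneg_iff.1
      (((ContinuousLinearMap.le_def _ _).1 hle).inner_nonneg_right (w s))).1
    rw [sub_apply, smul_apply, inner_sub_right, inner_smul_right, hR, hX, Complex.sub_re,
      Complex.re_ofReal_mul, Complex.ofReal_re, Complex.re_sum, sub_nonneg] at h1
    have h2 := sum_le_hasSum s (fun a _ => (Complex.nonneg_iff.1
      (posSemidef_entry_iff.2 hξ.1).diag_nonneg).1) (Complex.hasSum_re hξ.2)
    exact h1.trans (mul_le_of_le_one_right hk h2)
  have hle1 : ∀ s α, ∑ a ∈ s, ‖E.ψ α a‖ ^ 2 ≤ 1 := fun s α =>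
    sum_le_hasSum s (fun _ _ => by positivity) (hsum α)
  have hlim : Filter.Tendsto (fun s : Finset ι => ∫ α, (∑ a ∈ s, ‖E.ψ α a‖ ^ 2) ^ 2 ∂E.μ)
      Filter.atTop (𝓝 (∫ _, (1 : ℝ) ∂E.μ)) := by
    refine tendsto_integral_filter_of_dominated_convergence (fun _ => 1)
      (Filter.Eventually.of_forall fun s => ?_)
      (Filter.Eventually.of_forall fun s => ae_of_all _ fun α => ?_) (integrable_const _)
      (ae_of_all _ fun α => ?_)
    · have hc : Continuous fun x : Hilb ι => (∑ a ∈ s, ‖x a‖ ^ 2) ^ 2 :=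
        (continuous_finsetSum _ fun a _ => (continuous_coord a).norm.pow 2).pow 2
      exact hc.comp_aestronglyMeasurable E.meas
    · rw [Real.norm_of_nonneg (by positivity)]
      exact pow_le_one₀ (by positivity) (hle1 s α)
    · have h : Filter.Tendsto (fun s => ∑ a ∈ s, ‖E.ψ α a‖ ^ 2) Filter.atTop (𝓝 1) := hsum α
      simpa using h.pow 2
  simpa using le_of_tendsto' hlim hbound

/-! ### Ensembles of product states -/

theorem posSemidef_integral {Ω ι : Type*} [MeasurableSpace Ω] {μ : Measure Ω}
    {K : Ω → Matrix ι ι ℂ} (hfi : ∀ a b, Integrable (fun α => K α a b) μ)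
    (hK : ∀ α, (K α).PosSemidef) : (Matrix.of fun a b => ∫ α, K α a b ∂μ).PosSemidef := by
  refine posSemidef_iff_sum.2 fun s v => ?_
  have hi : ∀ a b, Integrable (fun α => star (v a) * K α a b * v b) μ := fun a b =>
    ((hfi a b).const_mul _).mul_const _
  have h : ∑ a ∈ s, ∑ b ∈ s, star (v a) * (∫ α, K α a b ∂μ) * v b =
      ∫ α, ∑ a ∈ s, ∑ b ∈ s, star (v a) * K α a b * v b ∂μ := by
    rw [integral_finsetSum _ fun a _ => integrable_finsetSum _ fun b _ => hi a b]
    refine Finset.sum_congr rfl fun a _ => ?_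
    rw [integral_finsetSum _ fun b _ => hi a b]
    refine Finset.sum_congr rfl fun b _ => ?_
    rw [integral_mul_const, integral_const_mul]
  simp only [Matrix.of_apply]
  rw [h]
  have hnn := fun α => Complex.nonneg_iff.1 (posSemidef_iff_sum.1 (hK α) s v)
  have hre : ∀ α, ∑ a ∈ s, ∑ b ∈ s, star (v a) * K α a b * v b =
      (((∑ a ∈ s, ∑ b ∈ s, star (v a) * K α a b * v b).re : ℝ) : ℂ) := fun α =>
    Complex.ext rfl (hnn α).2.symm
  rw [integral_congr_ae (ae_of_all _ hre), integral_complex_ofReal]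
  exact_mod_cast integral_nonneg fun α => (hnn α).1

theorem posSemidef_mul_star {ι : Type*} (χ : ι → ℂ) :
    (Matrix.of fun a b => χ a * star (χ b)).PosSemidef := by
  refine posSemidef_iff_sum.2 fun s v => ?_
  have h : (0 : ℂ) ≤ star (∑ b ∈ s, star (χ b) * v b) * ∑ b ∈ s, star (χ b) * v b :=
    star_mul_self_nonneg _
  rw [star_sum, Finset.sum_mul_sum] at h
  refine h.trans_eq (Finset.sum_congr rfl fun a _ => Finset.sum_congr rfl fun b _ => ?_)
  simp only [star_mul, star_star, Matrix.of_apply]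
  ring

/-- The partial transpose of a product vector state is again of rank one. -/
theorem exists_rankOne_partialTranspose {n : ℕ} {I : Fin n → Type} (J : Finset (Fin n))
    {x : (∀ j, I j) → ℂ} {φ : ∀ j, I j → ℂ} (hx : ∀ a, x a = ∏ j, φ j (a j)) :
    ∃ χ : (∀ j, I j) → ℂ, ∀ a b,
      star (x (J.piecewise b a)) * x (J.piecewise a b) = χ a * star (χ b) := by
  refine ⟨fun a => ∏ j, if j ∈ J then φ j (a j) else star (φ j (a j)), fun a b => ?_⟩
  simp only [hx, star_prod, ← Finset.prod_mul_distrib]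
  refine Finset.prod_congr rfl fun j _ => ?_
  by_cases hj : j ∈ J <;> simp [hj, mul_comm]

/-- The partial transpose of a pure state is at most the identity. -/
theorem one_sub_partialTranspose_posSemidef {n : ℕ} {I : Fin n → Type} (J : Finset (Fin n))
    [DecidableEq (∀ j, I j)] (u : Hilb (∀ j, I j)) (hu : ‖u‖ = 1) :
    (Matrix.of fun c d => (if c = d then 1 else 0) -
      u (J.piecewise d c) * star (u (J.piecewise c d))).PosSemidef := by
  refine posSemidef_iff_sum.2 fun s v => ?_
  set m : (∀ j, I j) → (∀ j, I j) → ℂ := fun c d =>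
    u (J.piecewise d c) * star (u (J.piecewise c d)) with hm
  set z : ℂ := ∑ c ∈ s, ∑ d ∈ s, star (v c) * m c d * v d with hz
  have hsplit : ∑ c ∈ s, ∑ d ∈ s, star (v c) *
      (Matrix.of fun c d => (if c = d then (1 : ℂ) else 0) -
      u (J.piecewise d c) * star (u (J.piecewise c d))) c d * v d =
      ((∑ c ∈ s, ‖v c‖ ^ 2 : ℝ) : ℂ) - z := by
    rw [hz, Complex.ofReal_sum, ← Finset.sum_sub_distrib]
    refine Finset.sum_congr rfl fun c hc => ?_
    simp only [Matrix.of_apply, mul_sub, sub_mul, Finset.sum_sub_distrib]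
    congr 1
    simp only [mul_ite, mul_one, mul_zero, ite_mul, zero_mul, Finset.sum_ite_eq, hc, if_true]
    rw [← Complex.normSq_eq_norm_sq, ← Complex.mul_conj, mul_comm]
    rfl
  have hstar : star z = z := by
    rw [hz, star_sum, Finset.sum_comm]
    refine Finset.sum_congr rfl fun c _ => ?_
    rw [star_sum]
    refine Finset.sum_congr rfl fun d _ => ?_
    simp only [hm, star_mul, star_star]
    ring
  -- Cauchy–Schwarz over pairs of labels: the form is bounded by the Hilbert–Schmidt norm of m,
  -- which is at most 1 because m is a rearrangement of the entries of a rank one projection.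
  have hnorm : ‖z‖ ≤ ∑ c ∈ s, ‖v c‖ ^ 2 := by
    have h1 : ‖z‖ ≤ ∑ p ∈ s ×ˢ s, (‖v p.1‖ * ‖v p.2‖) * ‖m p.1 p.2‖ := by
      rw [hz, ← Finset.sum_product']
      refine (norm_sum_le _ _).trans_eq (Finset.sum_congr rfl fun p _ => ?_)
      rw [norm_mul, norm_mul, norm_star]
      ring
    have h2 := Finset.sum_mul_sq_le_sq_mul_sq (s ×ˢ s) (fun p => ‖v p.1‖ * ‖v p.2‖)
      (fun p => ‖m p.1 p.2‖)
    have h3 : ∑ p ∈ s ×ˢ s, ‖m p.1 p.2‖ ^ 2 ≤ 1 := by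
      let e : (∀ j, I j) × (∀ j, I j) → (∀ j, I j) × (∀ j, I j) := fun x =>
        (J.piecewise x.2 x.1, J.piecewise x.1 x.2)
      have he : Function.Involutive e := fun x => by
        simp only [e, piecewise_piecewise_swap]
      have h4 := sum_normSq_le (tensorVec u (star u)) ((s ×ˢ s).map ⟨e, he.injective⟩)
      rw [norm_tensorVec, norm_star, hu, Finset.sum_map] at h4
      refine le_trans (Finset.sum_le_sum fun p _ => le_of_eq ?_) (h4.trans_eq (by norm_num))
      rfl
    have h5 : ∑ p ∈ s ×ˢ s, (‖v p.1‖ * ‖v p.2‖) ^ 2 = (∑ c ∈ s, ‖v c‖ ^ 2) ^ 2 := by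
      rw [sq (∑ c ∈ s, ‖v c‖ ^ 2), Finset.sum_mul_sum, ← Finset.sum_product']
      simp only [mul_pow]
    have h6 : ∑ p ∈ s ×ˢ s, (‖v p.1‖ * ‖v p.2‖) * ‖m p.1 p.2‖ ≤ ∑ c ∈ s, ‖v c‖ ^ 2 := by
      refine le_of_sq_le_sq (h2.trans ?_) (by positivity)
      rw [h5]
      exact mul_le_of_le_one_right (by positivity) h3
    exact h1.trans h6
  rw [hsplit, Complex.nonneg_iff]
  have him : z.im = 0 := Complex.conj_eq_iff_im.1 hstar
  refine ⟨?_, by rw [Complex.sub_im, Complex.ofReal_im, him, sub_zero]⟩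
  rw [Complex.sub_re, Complex.ofReal_re, sub_nonneg]
  exact (Complex.re_le_norm z).trans hnorm

section Product

variable {Ω : Type*} [MeasurableSpace Ω] {n : ℕ} {I I' : Fin n → Type}
  (E : Ensemble Ω (∀ j, I j)) (U : Hilb (∀ j, I j) →ₗᵢ[ℂ] Hilb (∀ j, I' j))

theorem entry_partialTranspose_partialTrace [∀ j, Countable (I' j)] (J : Finset (Fin n)) :
    entry (partialTranspose J (partialTrace (Rop E U))) =
      ptMatrix J (entry (partialTrace (Rop E U))) :=
  entry_ofMatrix (isHSMatrix_ptMatrix J (entry_partialTrace_Rop E U).1)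

theorem integrable_star_coord_mul (a b : ∀ j, I j) :
    Integrable (fun α => star (E.ψ α a) * E.ψ α b) E.μ := by
  have := E.isProb
  simpa [mul_comm] using integrable_coord_mul E.meas E.norm_one b a

/-- Partial transposition conjugates some tensor factors of each product vector, so positivity
survives averaging; the diagonal, hence the trace, is unchanged. This makes R_A^Γ a candidate for ξ
in the general bound. -/
theorem isState_partialTranspose_partialTrace [∀ j, Countable (I j)] [∀ j, Countable (I' j)]
    (hE : E.IsProduct) (J : Finset (Fin n)) :
    IsState (partialTranspose J (partialTrace (Rop E U))) := by
  have := E.isProb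
  refine ⟨posSemidef_entry_iff.1 ?_, ?_⟩
  · rw [entry_partialTranspose_partialTrace, (entry_partialTrace_Rop E U).2]
    refine posSemidef_integral (K := fun α => Matrix.of fun a b =>
      star (E.ψ α (J.piecewise b a)) * E.ψ α (J.piecewise a b))
      (fun a b => integrable_star_coord_mul E _ _) fun α => ?_
    obtain ⟨φ, -, hφ⟩ := hE α
    obtain ⟨χ, hχ⟩ := exists_rankOne_partialTranspose J hφ
    simp only [hχ]
    exact posSemidef_mul_star χ
  · rw [entry_partialTranspose_partialTrace, (entry_partialTrace_Rop E U).2]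
    have h := hasSum_average_diag E.meas E.norm_one
    simpa only [ptMatrix, Matrix.of_apply, piecewise_self, mul_comm] using h

/-- The difference is the average of (ψ*)^Γ ⊗ (1 − ψ'^Γ). The first factor is a rank one positive
matrix since ψ is a product, and the second is positive for any unit vector, entangled or not. -/
theorem partialTranspose₂_Rop_le [∀ j, Countable (I' j)] (hE : E.IsProduct)
    (J : Finset (Fin n)) : partialTranspose₂ J (Rop E U) ≤
      tensorOne (∀ j, I' j) (partialTranspose J (partialTrace (Rop E U))) := by
  classical
  have := E.isProb
  rw [le_iff_entry, entry_partialTranspose₂_Rop]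
  let K : Ω → Matrix ((∀ j, I j) × (∀ j, I' j)) ((∀ j, I j) × (∀ j, I' j)) ℂ := fun α =>
    Matrix.of fun p q => star (E.ψ α (J.piecewise q.1 p.1)) * E.ψ α (J.piecewise p.1 q.1) *
      ((if p.2 = q.2 then 1 else 0) -
        U (E.ψ α) (J.piecewise q.2 p.2) * star (U (E.ψ α) (J.piecewise p.2 q.2)))
  have hK1 : ∀ p q : (∀ j, I j) × (∀ j, I' j), Integrable (fun α =>
      star (E.ψ α (J.piecewise q.1 p.1)) * E.ψ α (J.piecewise p.1 q.1) * if p.2 = q.2 then 1 else 0) E.μ := fun p q =>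
    (integrable_star_coord_mul E _ _).mul_const _
  have hK2 := fun p q : (∀ j, I j) × (∀ j, I' j) => integrable_coord_mul
    (aestronglyMeasurable_Rvec E U) (norm_Rvec E U)
    (J.piecewise q.1 p.1, J.piecewise q.2 p.2) (J.piecewise p.1 q.1, J.piecewise p.2 q.2)
  have hsplit : ∀ p q α, K α p q = star (E.ψ α (J.piecewise q.1 p.1)) *
      E.ψ α (J.piecewise p.1 q.1) * (if p.2 = q.2 then 1 else 0) -
      Rvec E U α (J.piecewise q.1 p.1, J.piecewise q.2 p.2) *
        star (Rvec E U α (J.piecewise p.1 q.1, J.piecewise p.2 q.2)) := fun p q α => by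
    simp only [K, Matrix.of_apply, Rvec_apply, star_mul, star_star]
    ring
  have e : entry (tensorOne (∀ j, I' j) (partialTranspose J (partialTrace (Rop E U)))) -
      ptMatrix₂ J (entry (Rop E U)) = Matrix.of fun p q => ∫ α, K α p q ∂E.μ := by
    ext p q
    rw [Matrix.sub_apply, Matrix.of_apply, integral_congr_ae (ae_of_all _ (hsplit p q)),
      integral_sub (hK1 p q) (hK2 p q), integral_mul_const]
    congr 1
    · obtain ⟨a, c⟩ := p
      obtain ⟨b, d⟩ := q
      rw [entry_tensorOne, entry_partialTranspose_partialTrace, (entry_partialTrace_Rop E U).2,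
        mul_ite, mul_one, mul_zero]
      rfl
    · exact entry_Rop E U _ _
  rw [e]
  refine posSemidef_integral (fun p q => ?_) fun α => ?_
  · simp only [hsplit]
    exact (hK1 p q).sub (hK2 p q)
  · obtain ⟨φ, -, hφ⟩ := hE α
    obtain ⟨χ, hχ⟩ := exists_rankOne_partialTranspose J hφ
    have h := ((posSemidef_mul_star χ).submatrix
      (Prod.fst : (∀ j, I j) × (∀ j, I' j) → ∀ j, I j)).hadamard
      ((one_sub_partialTranspose_posSemidef J (U (E.ψ α))
        (by rw [U.norm_map, E.norm_one])).submatrix Prod.snd)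
    have e : K α = ((Matrix.of fun a b => χ a * star (χ b)).submatrix
        (Prod.fst : (∀ j, I j) × (∀ j, I' j) → ∀ j, I j) Prod.fst).hadamard
        ((Matrix.of fun c d => (if c = d then 1 else 0) - U (E.ψ α) (J.piecewise d c) *
          star (U (E.ψ α) (J.piecewise c d))).submatrix Prod.snd Prod.snd) := by
      ext p q
      simp only [K, Matrix.of_apply, Matrix.hadamard_apply, Matrix.submatrix_apply, hχ]
    rw [e]
    exact h

end Product

/-! ### The bounds -/

section Bounds

variable {Ω : Type*} [MeasurableSpace Ω] {n : ℕ} {I I' : Fin n → Type}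
  (E : Ensemble Ω (∀ j, I j)) (U : Hilb (∀ j, I j) →ₗᵢ[ℂ] Hilb (∀ j, I' j))

theorem minEntropyBound_eq (J : Finset (Fin n)) : minEntropyBound E U J =
    ⨅ (ξ : Op (∀ j, I j)) (_ : IsState ξ),
      dmax (partialTranspose₂ J (Rop E U)) (tensorOne (∀ j, I' j) ξ) := by
  rw [minEntropyBound, Hmin, neg_neg, ENNReal.exp_log]

theorem loccFidelity_le_pptFidelity : loccFidelity E U ≤ pptFidelity E U :=
  iSup₂_le fun Λ hΛ => le_iSup₂_of_le Λ hΛ.isPPT le_rfl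

theorem pptFidelity_le_minEntropyBound [∀ j, Countable (I j)] [∀ j, Countable (I' j)]
    (J : Finset (Fin n)) : pptFidelity E U ≤ minEntropyBound E U J := by
  rw [minEntropyBound_eq]
  exact iSup₂_le fun Λ hΛ => le_iInf₂ fun ξ hξ => le_iInf₂ fun l hl =>
    avgFidelity_le E U hΛ.1 (hΛ.2 J) hl.1.le hξ hl.2

theorem entry_partialTranspose₂_Rop_compl (J : Finset (Fin n)) :
    entry (partialTranspose₂ Jᶜ (Rop E U)) =
      (entry (partialTranspose₂ J (Rop E U))).transpose := by
  rw [entry_partialTranspose₂_Rop, entry_partialTranspose₂_Rop, ptMatrix₂_compl]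

/-- A full transposition of the inequality R^Γ ≤ λ ξ ⊗ 1 replaces ξ by its conjugate, which is again
a state. One inequality suffices, complementation being an involution. -/
theorem minEntropyBound_compl (J : Finset (Fin n)) :
    minEntropyBound E U Jᶜ = minEntropyBound E U J := by
  have h : ∀ J, minEntropyBound E U Jᶜ ≤ minEntropyBound E U J := fun J => by
    rw [minEntropyBound_eq, minEntropyBound_eq]
    refine le_iInf₂ fun ξ hξ => iInf₂_le_of_le (conjOp ξ) hξ.conjOp (le_of_eq ?_)
    exact dmax_eq_of_transpose (entry_partialTranspose₂_Rop_compl E U J)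
      (entry_tensorOne_transpose (entry_conjOp_of_isPositive hξ.1))
  refine le_antisymm (h J) ?_
  simpa using h Jᶜ

theorem one_le_minEntropyBound_empty [∀ j, Countable (I j)] : 1 ≤ minEntropyBound E U ∅ := by
  rw [minEntropyBound_eq]
  refine le_iInf₂ fun ξ hξ => le_iInf₂ fun l hl => ?_
  have e : partialTranspose₂ ∅ (Rop E U) = Rop E U := by
    refine op_ext ?_
    rw [entry_partialTranspose₂_Rop]
    ext p q
    simp [ptMatrix₂]
  rw [e] at hl
  exact ENNReal.one_le_ofReal.2 (one_le_of_Rop_le E U hl.1.le hξ hl.2)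

theorem minEntropyBound_le_productBound [∀ j, Countable (I j)] [∀ j, Countable (I' j)]
    (hE : E.IsProduct) (J : Finset (Fin n)) : minEntropyBound E U J ≤ productBound E U J := by
  rw [minEntropyBound_eq]
  exact iInf₂_le _ (isState_partialTranspose_partialTrace E U hE J)

theorem productBound_le_one [∀ j, Countable (I' j)] (hE : E.IsProduct) (J : Finset (Fin n)) :
    productBound E U J ≤ 1 :=
  iInf₂_le_of_le 1 ⟨one_pos, by simpa using partialTranspose₂_Rop_le E U hE J⟩ (by simp)

theorem productBound_compl [∀ j, Countable (I' j)] (J : Finset (Fin n)) :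
    productBound E U Jᶜ = productBound E U J := by
  refine dmax_eq_of_transpose (entry_partialTranspose₂_Rop_compl E U J)
    (entry_tensorOne_transpose ?_)
  rw [entry_partialTranspose_partialTrace, entry_partialTranspose_partialTrace, ptMatrix_compl]

/-- A function of subsets that is symmetric under complements and at least `1` at `∅` is at
least `min 1` of its infimum over the sets of size between `1` and `n / 2`. -/
theorem min_one_iInf_restrict_le {f : Finset (Fin n) → ℝ≥0∞} (hc : ∀ J, f Jᶜ = f J)
    (h0 : 1 ≤ f ∅) (J : Finset (Fin n)) :
    min 1 (⨅ (K : Finset (Fin n)) (_ : 1 ≤ K.card ∧ K.card ≤ n / 2), f K) ≤ f J := by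
  have hcard := J.card_compl_add_card
  rw [Fintype.card_fin] at hcard
  rcases J.eq_empty_or_nonempty with rfl | hJ
  · exact (min_le_left _ _).trans h0
  rcases Jᶜ.eq_empty_or_nonempty with hJc | hJc
  · rw [← hc, hJc]
    exact (min_le_left _ _).trans h0
  have h1 := hJ.card_pos
  have h2 := hJc.card_pos
  refine (min_le_right _ _).trans ?_
  by_cases h : J.card ≤ n / 2
  · exact iInf₂_le_of_le J ⟨h1, h⟩ le_rfl
  -- A set with more than n / 2 elements has a complement with at most n / 2, also for odd n.
  · exact iInf₂_le_of_le Jᶜ ⟨h2, by omega⟩ (hc J).le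

end Bounds

end LOCCBound

end

open LOCCBound in
theorem theorem1 {Ω : Type*} [MeasurableSpace Ω] {n : ℕ} {I I' : Fin n → Type}
    [∀ j, Countable (I j)] [∀ j, Countable (I' j)]
    (E : Ensemble Ω (∀ j, I j)) (U : Hilb (∀ j, I j) →ₗᵢ[ℂ] Hilb (∀ j, I' j)) :
    -- the general bound, for LOCC and for PPT simulations
    loccFidelity E U ≤ pptFidelity E U ∧
    loccFidelity E U ≤ ⨅ J : Finset (Fin n), minEntropyBound E U J ∧
    pptFidelity E U ≤ ⨅ J : Finset (Fin n), minEntropyBound E U J ∧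
    -- the other expressions for its right-hand side
    (⨅ J : Finset (Fin n), minEntropyBound E U J) =
      (⨅ J : Finset (Fin n), ⨅ (ξ : Op (∀ j, I j)) (_ : IsState ξ),
        dmax (partialTranspose₂ J (Rop E U)) (tensorOne (∀ j, I' j) ξ)) ∧
    (⨅ J : Finset (Fin n), minEntropyBound E U J) =
      (⨅ J : Finset (Fin n), ⨅ (κ : ℝ) (_ : 0 ≤ κ ∧ ∃ ξ : Op (∀ j, I j), IsState ξ ∧
        partialTranspose₂ J (Rop E U) ≤ (κ : ℂ) • tensorOne (∀ j, I' j) ξ), ENNReal.ofReal κ) ∧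
    -- restriction to `1 ≤ |J| ≤ ⌊n/2⌋`: only the trivial values `≥ 1` are lost
    (∀ J : Finset (Fin n), minEntropyBound E U Jᶜ = minEntropyBound E U J) ∧
    1 ≤ minEntropyBound E U ∅ ∧
    min 1 (⨅ J : Finset (Fin n), minEntropyBound E U J) =
      min 1 (⨅ (J : Finset (Fin n)) (_ : 1 ≤ J.card ∧ J.card ≤ n / 2), minEntropyBound E U J) ∧
    -- the simplified bound for ensembles of product states
    (E.IsProduct →
      loccFidelity E U ≤ ⨅ J : Finset (Fin n), productBound E U J ∧
      pptFidelity E U ≤ ⨅ J : Finset (Fin n), productBound E U J ∧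
      (⨅ J : Finset (Fin n), productBound E U J) ≤ 1 ∧
      (∀ J : Finset (Fin n), productBound E U J ≤ 1) ∧
      (∀ J : Finset (Fin n), productBound E U Jᶜ = productBound E U J) ∧
      (2 ≤ n → (⨅ J : Finset (Fin n), productBound E U J) =
        ⨅ (J : Finset (Fin n)) (_ : 1 ≤ J.card ∧ J.card ≤ n / 2), productBound E U J)) := by
  have hppt := le_iInf fun J => pptFidelity_le_minEntropyBound E U J
  have hmin : ∀ J, min 1 (⨅ (K : Finset (Fin n)) (_ : 1 ≤ K.card ∧ K.card ≤ n / 2),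
      minEntropyBound E U K) ≤ minEntropyBound E U J :=
    min_one_iInf_restrict_le (minEntropyBound_compl E U) (one_le_minEntropyBound_empty E U)
  refine ⟨loccFidelity_le_pptFidelity E U, (loccFidelity_le_pptFidelity E U).trans hppt, hppt,
    iInf_congr fun J => minEntropyBound_eq E U J,
    iInf_congr fun J => (minEntropyBound_eq E U J).trans (iInf_dmax_eq _),
    minEntropyBound_compl E U, one_le_minEntropyBound_empty E U,
    le_antisymm (min_le_min le_rfl (le_iInf₂ fun J _ => iInf_le _ J))
      (le_min (min_le_left _ _) (le_iInf hmin)), fun hE => ?_⟩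
  have hprod : pptFidelity E U ≤ ⨅ J : Finset (Fin n), productBound E U J :=
    hppt.trans (iInf_mono fun J => minEntropyBound_le_productBound E U hE J)
  refine ⟨(loccFidelity_le_pptFidelity E U).trans hprod, hprod,
    (iInf_le _ ∅).trans (productBound_le_one E U hE ∅), productBound_le_one E U hE,
    productBound_compl E U, fun hn => ?_⟩
  refine le_antisymm (le_iInf₂ fun J _ => iInf_le _ J) (le_iInf fun J => ?_)
  have h := min_one_iInf_restrict_le (productBound_compl E U)
    ((one_le_minEntropyBound_empty E U).trans (minEntropyBound_le_productBound E U hE ∅)) J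
  rwa [min_eq_right] at h
  -- For n ≥ 2 a singleton is admissible and its value is at most 1, so the minimum with 1 can be
  -- dropped.
  refine iInf₂_le_of_le {⟨0, by omega⟩} ?_ (productBound_le_one E U hE _)
  rw [Finset.card_singleton]
  omega
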